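/- For sets $A\subseteq\omega$ and functions regarded as sets of pairs, $\subseteq^*$ denotes inclusion modulo a finite set. For an integer $\ell\ge 2$ let $\mathbb P_\ell$ be the set of all one-to-one partial functions $g$ from $\omega$ to $\omega$ such that - for all $i\in\operatorname{dom}(g)$ and $n\in\omega$: $g(i)\in\ell^{n+1}\setminus\ell^n$ if and only if $i\in \ell^{n+1}\setminus\ell^n$ (here $\ell^{n+1}\setminus\ell^n=\{k:\ell^n\le k<\ell^{n+1}\}$); - for all $i\in\operatorname{dom}(g)$: $g(i),\dots,g^\ell(i)$ are defined and $\{i,g(i),\dots,g^{\ell}(i)\}$ has precisely $\ell$ elements; - $\limsup_{n\to\infty}|(\ell^{n+1}\setminus\ell^n)\setminus\operatorname{dom}(g)|=\infty$. Let $\mathbb P_1$ be the set of all partial functions $g$ from $\omega$ into $\{0,1\}$ with $\limsup_{n\to\infty}|(2^{n+1}\setminus 2^n)\setminus\operatorname{dom}(g)|=\infty$. For every $\ell\ge1$, $\mathbb P_\ell$ is ordered by: $q$ is stronger than $p$ if $p\subseteq^* q$. Write $\mathbb N^*=\beta\mathbb N\setminus\mathbb N$ for the space of free ultrafilters on the countable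 discrete set $\mathbb N$ (identified with $\omega$). A point $x\in\mathbb N^*$ is a tie-point if there are closed sets $A,B$ with $A\cup B=\mathbb N^*$ and $A\cap B=\{x\}$ such that $x$ is an accumulation point of both $A$ and $B$. For $n\ge1$, $\tau(x)\ge n$ means that $\mathbb N^*\setminus\{x\}$ can be partitioned into $n$ disjoint (relatively) clopen subsets, each accumulating to $x$. **Proposition.** Let $L\subseteq\{1,2,3,\dots\}$ and let $\mathbb P^*=\prod_{\ell\in L}\mathbb P_\ell$ be the full support product, ordered coordinatewise. If $G$ is a $\mathbb P^*$-generic filter over $V$, then in $V[G]$, for each $\ell\in L$, there is a tie-point $x_\ell\in\mathbb N^*$ with $\tau(x_\ell)\ge\ell$. (That is, every condition of $\mathbb P^*$ forces this statement.) -/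

import Mathlib

universe u v

namespace TieForcing

/-! ## Formulas of set theory

Formulas in the language `{∈, =}` with parameters from `V`; a bound variable is
represented by a function on `V`.  The primitive connectives are negation, conjunction
and the universal quantifier, the others are the classical abbreviations. -/

inductive Form (V : Type u) : Type u
  | mem (x y : V) : Form V
  | eq (x y : V) : Form V
  | neg (φ : Form V) : Form V
  | and (φ ψ : Form V) : Form V
  | all (φ : V → Form V) : Form V

namespace Form

variable {V : Type u}

def or (φ ψ : Form V) : Form V := neg (and (neg φ) (neg ψ))

def imp (φ ψ : Form V) : Form V := neg (and φ (neg ψ))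

def iff (φ ψ : Form V) : Form V := and (imp φ ψ) (imp ψ φ)

def ex (φ : V → Form V) : Form V := neg (all fun x => neg (φ x))

def verum : Form V := all fun x => eq x x

/-- The conjunction of finitely many formulas. -/
def bigAnd : (n : ℕ) → (Fin n → Form V) → Form V
  | 0, _ => verum
  | n + 1, φ => and (φ 0) (bigAnd n fun i => φ i.succ)

/-- The disjunction of finitely many formulas. -/
def bigOr (n : ℕ) (φ : Fin n → Form V) : Form V := neg (bigAnd n fun i => neg (φ i))

/-- A block `∃ x₀ … xₙ₋₁` of existential quantifiers. -/
def exs : (n : ℕ) → ((Fin n → V) → Form V) → Form V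
  | 0, φ => φ Fin.elim0
  | n + 1, φ => ex fun x => exs n fun c => φ (Fin.cons x c)

end Form

infix:60 " ∊ " => Form.mem
infix:60 " ≐ " => Form.eq
infixr:45 " ⩑ " => Form.and
infixr:40 " ⩒ " => Form.or
infixr:35 " ⇾ " => Form.imp
infix:30 " ⇿ " => Form.iff
prefix:70 "∼" => Form.neg

open Form

section Notions

variable {V : Type u}

/-! ### Basic notions -/

def isEmpty (e : V) : Form V := all fun z => ∼(z ∊ e)

def isSubset (a b : V) : Form V := all fun z => z ∊ a ⇾ z ∊ b

/-- `s = {n}` -/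
def isSingleton (s n : V) : Form V := all fun z => z ∊ s ⇿ z ≐ n

/-- `c = a ∩ b` -/
def isInter (c a b : V) : Form V := all fun z => z ∊ c ⇿ (z ∊ a ⩑ z ∊ b)

/-- `c = a ∖ b` -/
def isDiff (c a b : V) : Form V := all fun z => z ∊ c ⇿ (z ∊ a ⩑ ∼(z ∊ b))

/-- `s = y ∪ {y}` -/
def isSucc (s y : V) : Form V := all fun z => z ∊ s ⇿ (z ∊ y ⩒ z ≐ y)

def isInductiveSet (I : V) : Form V :=
  (ex fun e => isEmpty e ⩑ e ∊ I) ⩑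
  (all fun y => y ∊ I ⇾ ex fun s => isSucc s y ⩑ s ∊ I)

/-- `N = ω`, the intersection of all inductive sets -/
def isOmega (N : V) : Form V :=
  all fun z => z ∊ N ⇿ (all fun I => isInductiveSet I ⇾ z ∊ I)

/-! ### The space `N* = βN ∖ N` -/

/-- `x` is a point of `N*`, that is, a free ultrafilter on the set `N`. -/
def isPoint (N x : V) : Form V :=
  (all fun a => a ∊ x ⇾ isSubset a N) ⩑
  N ∊ x ⩑
  (all fun e => isEmpty e ⇾ ∼(e ∊ x)) ⩑
  (all fun a => all fun b => a ∊ x ⇾ isSubset a b ⇾ isSubset b N ⇾ b ∊ x) ⩑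
  (all fun a => all fun b => all fun c => a ∊ x ⇾ b ∊ x ⇾ isInter c a b ⇾ c ∊ x) ⩑
  (all fun a => all fun b => isSubset a N ⇾ isDiff b N a ⇾ (a ∊ x ⩒ b ∊ x)) ⩑
  (all fun n => all fun s => n ∊ N ⇾ isSingleton s n ⇾ ∼(s ∊ x))

/-- `U` is an open set of `N*`: a set of points that contains, with each of its points,
a basic set `{y ∈ N* : a ∈ y}` around it. -/
def isOpenSet (N U : V) : Form V :=
  (all fun x => x ∊ U ⇾ isPoint N x) ⩑
  (all fun x => x ∊ U ⇾ ex fun a => a ∊ x ⩑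
    (all fun y => isPoint N y ⇾ a ∊ y ⇾ y ∊ U))

/-- `K` is a closed set of `N*`: a set of points whose complement in `N*` is open. -/
def isClosedSet (N K : V) : Form V :=
  (all fun x => x ∊ K ⇾ isPoint N x) ⩑
  (ex fun U => isOpenSet N U ⩑ (all fun x => isPoint N x ⇾ (x ∊ U ⇿ ∼(x ∊ K))))

/-- `x` is an accumulation point of `C`: every open set of `N*` around `x` meets `C ∖ {x}`. -/
def accumulatesTo (N C x : V) : Form V :=
  all fun U => isOpenSet N U ⇾ x ∊ U ⇾ ex fun y => y ∊ U ⩑ y ∊ C ⩑ ∼(y ≐ x)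

/-- `x` is a tie-point of `N*`: it is a point of `N*`, and there are closed sets `A`, `B`
with `A ∪ B = N*` and `A ∩ B = {x}` such that `x` is an accumulation point of both. -/
def isTiePoint (N x : V) : Form V :=
  isPoint N x ⩑
  (ex fun A => ex fun B =>
    isClosedSet N A ⩑ isClosedSet N B ⩑
    (all fun y => isPoint N y ⇾ (y ∊ A ⩒ y ∊ B)) ⩑
    (all fun y => (y ∊ A ⩑ y ∊ B) ⇿ y ≐ x) ⩑
    accumulatesTo N A x ⩑ accumulatesTo N B x)

/-- `C` is a subset of the subspace `N* ∖ {x}` that is open and closed in it: both `C` and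
`(N* ∖ {x}) ∖ C` are traces on `N* ∖ {x}` of open sets of `N*`. -/
def isClopenOff (N x C : V) : Form V :=
  (all fun y => y ∊ C ⇾ (isPoint N y ⩑ ∼(y ≐ x))) ⩑
  (ex fun U => isOpenSet N U ⩑
    (all fun y => isPoint N y ⇾ ∼(y ≐ x) ⇾ (y ∊ U ⇿ y ∊ C))) ⩑
  (ex fun U => isOpenSet N U ⩑
    (all fun y => isPoint N y ⇾ ∼(y ≐ x) ⇾ (y ∊ U ⇿ ∼(y ∊ C))))

/-- `τ(x) ≥ n`: the space `N* ∖ {x}` can be partitioned into `n` disjoint clopen subsets,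
each of them accumulating to `x`. -/
def tauGe (n : ℕ) (N x : V) : Form V :=
  exs n fun C =>
    (bigAnd n fun i => isClopenOff N x (C i) ⩑ accumulatesTo N (C i) x) ⩑
    (bigAnd n fun i => bigAnd n fun j =>
      if i = j then verum else all fun y => ∼(y ∊ C i ⩑ y ∊ C j)) ⩑
    (all fun y => isPoint N y ⇾ ∼(y ≐ x) ⇾ bigOr n fun i => y ∊ C i)

/-- The sentence "there is a tie-point `x ∈ ω*` with `τ(x) ≥ n`". -/
def existsTiePointTauGe (V : Type u) (n : ℕ) : Form V :=
  ex fun N => isOmega N ⩑ ex fun x => isTiePoint N x ⩑ tauGe n N x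

end Notions

/-! ## Forcing -/

/-- `P`-names: small families of pairs (name, condition).  The ground model is the universe
of the sets that are built from index types in `Type v`. -/
inductive PName (P : Type u) : Type (max u (v + 1))
  | mk (ι : Type v) (nm : ι → PName P) (cond : ι → P) : PName P

section Forcing

variable {P : Type u} [Preorder P]

/-- `p ⊩ x = y` (a smaller condition is a stronger one): for every member `(z, s)` of either
name, densely many conditions below `p` and `s` find a member `(z', t)` of the other name
such that they are below `t` and force `z = z'`. -/
def forcesEq : PName.{u, v} P → PName.{u, v} P → P → Prop
  | .mk _ x s, .mk _ y t => fun p =>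
    (∀ i, ∀ q, q ≤ p → q ≤ s i → ∃ r, r ≤ q ∧ ∃ j, r ≤ t j ∧ forcesEq (x i) (y j) r) ∧
    (∀ j, ∀ q, q ≤ p → q ≤ t j → ∃ r, r ≤ q ∧ ∃ i, r ≤ s i ∧ forcesEq (x i) (y j) r)

/-- `p ⊩ x ∈ y`: densely many `r ≤ p` are below `t` and force `x = z`
for some member `(z, t)` of `y`. -/
def forcesMem (x : PName.{u, v} P) : PName.{u, v} P → P → Prop
  | .mk _ y t => fun p => ∀ q, q ≤ p → ∃ r, r ≤ q ∧ ∃ j, r ≤ t j ∧ forcesEq x (y j) r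

/-- The forcing relation `p ⊩ φ` for formulas whose parameters are `P`-names. -/
def Forces (p : P) : Form (PName.{u, v} P) → Prop
  | .mem x y => forcesMem x y p
  | .eq x y => forcesEq x y p
  | .neg φ => ∀ q, q ≤ p → ¬ Forces q φ
  | .and φ ψ => Forces p φ ∧ Forces p ψ
  | .all φ => ∀ x, Forces p (φ x)

end Forcing

/-- `φ` holds in `V[G]` for every `P`-generic filter `G` over `V`, that is,
`φ` is forced by every condition. -/
def HoldsInGenericExtensions (P : Type u) [Preorder P] (φ : Form (PName.{u, v} P)) : Prop :=
  ∀ p : P, Forces p φ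

/-! ## The partial orders `P_ℓ` -/

/-- The interval `b ^ (n + 1) ∖ b ^ n` of natural numbers. -/
def block (b n : ℕ) : Set ℕ := Set.Ico (b ^ n) (b ^ (n + 1))

/-- The domain of a partial function. -/
def pdom (g : ℕ → Option ℕ) : Set ℕ := {i | (g i).isSome}

/-- `limsup_n |(b ^ (n + 1) ∖ b ^ n) ∖ A| = ω`. -/
def Growth (b : ℕ) (A : Set ℕ) : Prop :=
  Filter.limsup (fun n => (block b n \ A).encard) Filter.atTop = ⊤

/-- The iterate `g ^ k` of a partial function, as a partial function. -/
def piter (g : ℕ → Option ℕ) : ℕ → ℕ → Option ℕ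
  | 0, i => some i
  | k + 1, i => (piter g k i).bind g

/-- The conditions of `P_ℓ` for `ℓ ≥ 2`: the one-to-one partial functions `g` on `ω` that
respect the intervals `ℓ ^ (n + 1) ∖ ℓ ^ n`, for which `g i, …, g ^ ℓ i` are defined and
`{i, g i, …, g ^ ℓ i}` has precisely `ℓ` elements for all `i ∈ dom g`, and whose domain
satisfies the growth condition. -/
structure IsCyclicCond (ℓ : ℕ) (g : ℕ → Option ℕ) : Prop where
  inj : ∀ i j k, g i = some k → g j = some k → i = j
  block : ∀ i k, g i = some k → ∀ n, k ∈ block ℓ n ↔ i ∈ block ℓ n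
  orbit_defined : ∀ i ∈ pdom g, ∀ k ≤ ℓ, (piter g k i).isSome
  orbit_card : ∀ i ∈ pdom g, {j | ∃ k ≤ ℓ, piter g k i = some j}.encard = ℓ
  growth : Growth ℓ (pdom g)

/-- The conditions of `P_1`: the partial functions from `ω` into `2 = {0, 1}` (that is, the
disjoint pairs `(g⁻¹(0), g⁻¹(1))`) whose domain satisfies the growth condition for the
intervals `2 ^ (n + 1) ∖ 2 ^ n`. -/
structure IsSplitCond (g : ℕ → Option ℕ) : Prop where
  two : ∀ i k, g i = some k → k < 2
  growth : Growth 2 (pdom g)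

/-- The underlying set of `P_ℓ`. -/
def Cond (ℓ : ℕ) : Type :=
  {g : ℕ → Option ℕ // if ℓ = 1 then IsSplitCond g else IsCyclicCond ℓ g}

/-- `f ⊆* g`: all but finitely many pairs of (the graph of) `f` belong to `g`. -/
def AlmostSubset (f g : ℕ → Option ℕ) : Prop :=
  {i | ∃ k, f i = some k ∧ g i ≠ some k}.Finite

/-- `q` is stronger than `p` if `p ⊆* q`. -/
instance (ℓ : ℕ) : Preorder (Cond ℓ) where
  le q p := AlmostSubset p.1 q.1
  le_refl p := by
    simp [AlmostSubset]
  le_trans r q p hrq hqp := by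
    refine (hqp.union hrq).subset ?_
    rintro i ⟨k, hk, hk'⟩
    by_cases h : q.1 i = some k
    · exact Or.inr ⟨k, h, hk'⟩
    · exact Or.inl ⟨k, hk, h⟩

/-- The full support product of the partial orders `P_ℓ`, `ℓ ∈ L`, ordered coordinatewise. -/
abbrev PStar (L : Set ℕ) : Type := ∀ ℓ : L, Cond ℓ

end TieForcing

namespace TieForcing
open Form

/-! ## The forcing relation -/

section Basic

variable {P : Type u} [Preorder P] {p q : P}

/-! Fix a coordinate `ℓ` of the generic filter. The complements of the domains of its conditions
generate, modulo finite sets, a free ultrafilter `x`, and this is the tie-point. Countable closure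
is what makes `ω*` of the extension accessible: no new subsets of `ω` appear
(`exists_forces_eq_setName`), so a point is a consistent way of deciding ground model sets
(`PointAt`, `forces_isPoint_iff`), and free ultrafilters of the ground model remain points. That `x`
is ultra is a density argument: if the uncoloured places of `g` have unbounded size in the blocks,
so does their part in `A` or in its complement, and the other part can be absorbed into the domain
(`Cond.exists_decides`). A condition colours its domain: by its value if `ℓ = 1`, and by the rank of
a place in its `ℓ`-cycle if `ℓ ≥ 2`. Colours survive extension up to finitely many places, so each
set `s` of colours yields the open set of points that contain the `s`-coloured places of some
generic condition. Disjoint `s` give disjoint open sets, none of which contains `x`. They cover the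
rest: if `y ≠ x`, some `A ∈ y` has its complement in `x`, so `A` is almost contained in the domain
of a generic condition and splits into finitely many colour classes, one of which is in `y`
(`ColoringSystem.exists_meetsColor`). Each accumulates to `x`, since any colour can be put on
infinitely many uncoloured places (`ColoringSystem.forces_accumulatesTo`). Grouping the colours into
two or into `ℓ` classes gives the tie-point structure and `τ(x) ≥ ℓ`. The axioms in `ColoringSystem`
isolate what this needs of the forcing. They pass to the full support product, because each density
argument changes one coordinate only; countable closure passes coordinatewise. -/

theorem forces_neg {φ : Form (PName.{u, v} P)} : Forces p (∼φ) ↔ ∀ q ≤ p, ¬ Forces q φ :=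
  Iff.rfl

theorem forces_and {φ ψ : Form (PName.{u, v} P)} :
    Forces p (φ ⩑ ψ) ↔ Forces p φ ∧ Forces p ψ := Iff.rfl

theorem forces_mem_mk {x : PName.{u, v} P} {ι : Type v} {nm : ι → PName.{u, v} P} {c : ι → P} :
    Forces p (x ∊ .mk ι nm c) ↔
      ∀ q ≤ p, ∃ r ≤ q, ∃ j, r ≤ c j ∧ Forces r (x ≐ nm j) := Iff.rfl

theorem forces_eq_mk {ι κ : Type v} {x : ι → PName.{u, v} P} {s : ι → P}
    {y : κ → PName.{u, v} P} {t : κ → P} :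
    Forces p (.mk ι x s ≐ .mk κ y t) ↔
      (∀ i, ∀ q ≤ p, q ≤ s i → ∃ r ≤ q, ∃ j, r ≤ t j ∧ Forces r (x i ≐ y j)) ∧
      (∀ j, ∀ q ≤ p, q ≤ t j → ∃ r ≤ q, ∃ i, r ≤ s i ∧ Forces r (x i ≐ y j)) := Iff.rfl

theorem Forces.mono {φ : Form (PName.{u, v} P)} (h : Forces p φ) (hq : q ≤ p) :
    Forces q φ := by
  induction φ generalizing p q with
  | mem x y =>
    cases y
    exact fun r hr => h r (hr.trans hq)
  | eq x y =>
    cases x; cases y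
    exact ⟨fun i r hr => h.1 i r (hr.trans hq), fun i r hr => h.2 i r (hr.trans hq)⟩
  | neg φ _ => exact fun r hr => h r (hr.trans hq)
  | and φ ψ h₁ h₂ => exact ⟨h₁ h.1 hq, h₂ h.2 hq⟩
  | all φ ih => exact fun x => ih x (h x) hq

/-- The clauses for `∈` and `=` already ask only for dense sets of witnesses, and the connectives
preserve this. It allows names to be identified, or statements decided, after strengthening the
condition. -/
theorem forces_of_dense {φ : Form (PName.{u, v} P)} (h : ∀ q ≤ p, ∃ r ≤ q, Forces r φ) :
    Forces p φ := by
  induction φ generalizing p with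
  | mem x y =>
    cases y
    intro q hq
    obtain ⟨r, hr, hf⟩ := h q hq
    obtain ⟨s, hs, hf⟩ := hf r le_rfl
    exact ⟨s, hs.trans hr, hf⟩
  | eq x y =>
    cases x; cases y
    refine ⟨fun i q hq hi => ?_, fun i q hq hi => ?_⟩
    all_goals obtain ⟨r, hr, hf⟩ := h q hq
    · obtain ⟨s, hs, hf⟩ := hf.1 i r le_rfl (hr.trans hi)
      exact ⟨s, hs.trans hr, hf⟩
    · obtain ⟨s, hs, hf⟩ := hf.2 i r le_rfl (hr.trans hi)
      exact ⟨s, hs.trans hr, hf⟩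
  | neg φ _ =>
    intro q hq hφ
    obtain ⟨r, hr, hf⟩ := h q hq
    exact hf r le_rfl (hφ.mono hr)
  | and φ ψ h₁ h₂ =>
    refine ⟨h₁ fun q hq => ?_, h₂ fun q hq => ?_⟩
    all_goals obtain ⟨r, hr, hf⟩ := h q hq
    exacts [⟨r, hr, hf.1⟩, ⟨r, hr, hf.2⟩]
  | all φ ih =>
    intro x
    refine ih x fun q hq => ?_
    obtain ⟨r, hr, hf⟩ := h q hq
    exact ⟨r, hr, hf x⟩

theorem exists_forces_neg {φ : Form (PName.{u, v} P)} (h : ¬ Forces p φ) :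
    ∃ q ≤ p, Forces q (∼φ) := by
  by_contra! hc
  refine h (forces_of_dense fun q hq => ?_)
  have := hc q hq
  rw [forces_neg] at this
  push Not at this
  exact this

theorem forces_by_contra {φ : Form (PName.{u, v} P)} (h : ∀ q ≤ p, ¬ Forces q (∼φ)) :
    Forces p φ := by
  by_contra hc
  obtain ⟨q, hq, hφ⟩ := exists_forces_neg hc
  exact h q hq hφ

theorem exists_decides (p : P) (φ : Form (PName.{u, v} P)) :
    ∃ q ≤ p, Forces q φ ∨ Forces q (∼φ) := by
  by_cases h : Forces p φ
  · exact ⟨p, le_rfl, Or.inl h⟩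
  · obtain ⟨q, hq, hφ⟩ := exists_forces_neg h
    exact ⟨q, hq, Or.inr hφ⟩

theorem forces_imp {φ ψ : Form (PName.{u, v} P)} :
    Forces p (φ ⇾ ψ) ↔ ∀ q ≤ p, Forces q φ → Forces q ψ := by
  refine ⟨fun h q hq hφ => forces_by_contra fun r hr hψ => ?_, fun h q hq hφ => ?_⟩
  · exact h r (hr.trans hq) ⟨hφ.mono hr, hψ⟩
  · exact hφ.2 q le_rfl (h q hq hφ.1)

theorem forces_iff {φ ψ : Form (PName.{u, v} P)} :
    Forces p (φ ⇿ ψ) ↔ ∀ q ≤ p, Forces q φ ↔ Forces q ψ := by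
  refine (and_congr forces_imp forces_imp).trans ?_
  exact ⟨fun h q hq => ⟨h.1 q hq, h.2 q hq⟩,
    fun h => ⟨fun q hq => (h q hq).1, fun q hq => (h q hq).2⟩⟩

theorem forces_or {φ ψ : Form (PName.{u, v} P)} :
    Forces p (φ ⩒ ψ) ↔ ∀ q ≤ p, ∃ r ≤ q, Forces r φ ∨ Forces r ψ := by
  refine ⟨fun h q hq => ?_, fun h q hq hn => ?_⟩
  · by_contra! hc
    exact h q hq ⟨fun r hr hf => (hc r hr).1 hf, fun r hr hf => (hc r hr).2 hf⟩
  · obtain ⟨r, hr, hf | hf⟩ := h q hq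
    exacts [hn.1 r hr hf, hn.2 r hr hf]

theorem forces_ex {φ : PName.{u, v} P → Form (PName.{u, v} P)} :
    Forces p (.ex φ) ↔ ∀ q ≤ p, ∃ r ≤ q, ∃ x, Forces r (φ x) := by
  refine ⟨fun h q hq => ?_, fun h q hq hn => ?_⟩
  · by_contra! hc
    exact h q hq fun x r hr hf => hc r hr x hf
  · obtain ⟨r, hr, x, hf⟩ := h q hq
    exact hn x r hr hf

theorem forces_ex_of {φ : PName.{u, v} P → Form (PName.{u, v} P)} (x : PName.{u, v} P)
    (h : Forces p (φ x)) : Forces p (.ex φ) :=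
  forces_ex.2 fun q hq => ⟨q, le_rfl, x, h.mono hq⟩

/-! ### Equality -/

theorem forces_eq_refl (x : PName.{u, v} P) : ∀ p : P, Forces p (x ≐ x) := by
  induction x with
  | mk ι nm c ih =>
    exact fun p => ⟨fun i q _ hi => ⟨q, le_rfl, i, hi, ih i q⟩,
      fun i q _ hi => ⟨q, le_rfl, i, hi, ih i q⟩⟩

theorem forces_verum : Forces p (verum : Form (PName.{u, v} P)) :=
  fun x => forces_eq_refl x p

theorem Forces.symm {x y : PName.{u, v} P} (h : Forces p (x ≐ y)) : Forces p (y ≐ x) := by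
  induction x generalizing y p with
  | mk ι x s ih =>
    cases y with
    | mk κ y t =>
      refine ⟨fun i q hq hi => ?_, fun i q hq hi => ?_⟩
      · obtain ⟨r, hr, j, hj, hf⟩ := h.2 i q hq hi
        exact ⟨r, hr, j, hj, ih j hf⟩
      · obtain ⟨r, hr, j, hj, hf⟩ := h.1 i q hq hi
        exact ⟨r, hr, j, hj, ih i hf⟩

theorem Forces.trans {x y z : PName.{u, v} P} (h : Forces p (x ≐ y)) (h' : Forces p (y ≐ z)) :
    Forces p (x ≐ z) := by
  induction x generalizing y z p with
  | mk ι x s ih =>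
    cases y; cases z
    refine ⟨fun i q hq hi => ?_, fun i q hq hi => ?_⟩
    · obtain ⟨r, hr, j, hj, hf⟩ := (forces_eq_mk.1 h).1 i q hq hi
      obtain ⟨r', hr', k, hk, hf'⟩ := (forces_eq_mk.1 h').1 j r (hr.trans hq) hj
      exact ⟨r', hr'.trans hr, k, hk, ih i (hf.mono hr') hf'⟩
    · obtain ⟨r, hr, j, hj, hf⟩ := (forces_eq_mk.1 h').2 i q hq hi
      obtain ⟨r', hr', k, hk, hf'⟩ := (forces_eq_mk.1 h).2 j r (hr.trans hq) hj
      exact ⟨r', hr'.trans hr, k, hk, ih k hf' (hf.mono hr')⟩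

theorem Forces.mem_congr_left {x y z : PName.{u, v} P} (h : Forces p (x ≐ y))
    (hx : Forces p (x ∊ z)) : Forces p (y ∊ z) := by
  cases z
  intro q hq
  obtain ⟨r, hr, j, hj, hf⟩ := forces_mem_mk.1 hx q hq
  exact ⟨r, hr, j, hj, (h.mono (hr.trans hq)).symm.trans hf⟩

theorem Forces.mem_congr_right {x y z : PName.{u, v} P} (h : Forces p (x ≐ y))
    (hx : Forces p (z ∊ x)) : Forces p (z ∊ y) := by
  cases x; cases y
  intro q hq
  obtain ⟨r, hr, j, hj, hf⟩ := forces_mem_mk.1 hx q hq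
  obtain ⟨r', hr', k, hk, hf'⟩ := (forces_eq_mk.1 h).1 j r (hr.trans hq) hj
  exact ⟨r', hr'.trans hr, k, hk, (hf.mono hr').trans hf'⟩

theorem forces_mem_of_le {ι : Type v} {nm : ι → PName.{u, v} P} {c : ι → P} (i : ι)
    (h : p ≤ c i) : Forces p (nm i ∊ .mk ι nm c) :=
  fun q hq => ⟨q, le_rfl, i, hq.trans h, forces_eq_refl _ _⟩

theorem forces_eq_of_mem_iff {x y : PName.{u, v} P}
    (h : ∀ z, ∀ q ≤ p, Forces q (z ∊ x) ↔ Forces q (z ∊ y)) : Forces p (x ≐ y) := by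
  cases x; cases y
  refine ⟨fun i q hq hi => (h _ q hq).1 (forces_mem_of_le i hi) q le_rfl, fun i q hq hi => ?_⟩
  obtain ⟨r, hr, j, hj, hf⟩ :=
    forces_mem_mk.1 ((h _ q hq).2 (forces_mem_of_le i hi)) q le_rfl
  exact ⟨r, hr, j, hj, hf.symm⟩

/-- Foundation, by induction on names: a member forced equal to `x` would be forced to belong to
itself. It separates the names of distinct numerals. -/
theorem not_forces_mem_self (x : PName.{u, v} P) : ∀ p : P, ¬ Forces p (x ∊ x) := by
  induction x with
  | mk ι nm c ih =>
    intro p h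
    obtain ⟨r, hr, j, hj, hf⟩ := forces_mem_mk.1 h p le_rfl
    exact ih j r (hf.mem_congr_right (forces_mem_of_le j hj))

/-! ### Finite conjunctions, disjunctions and blocks of quantifiers -/

theorem forces_bigAnd {n : ℕ} {φ : Fin n → Form (PName.{u, v} P)} :
    Forces p (bigAnd n φ) ↔ ∀ i, Forces p (φ i) := by
  induction n with
  | zero => exact ⟨fun _ i => i.elim0, fun _ => forces_verum⟩
  | succ n ih =>
    rw [bigAnd, forces_and, ih, Fin.forall_fin_succ]

theorem forces_bigOr {n : ℕ} {φ : Fin n → Form (PName.{u, v} P)} :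
    Forces p (bigOr n φ) ↔ ∀ q ≤ p, ∃ r ≤ q, ∃ i, Forces r (φ i) := by
  refine ⟨fun h q hq => ?_, fun h q hq hn => ?_⟩
  · by_contra! hc
    exact h q hq (forces_bigAnd.2 fun i r hr hf => hc r hr i hf)
  · obtain ⟨r, hr, i, hf⟩ := h q hq
    exact forces_bigAnd.1 hn i r hr hf

theorem forces_exs_of {n : ℕ} {φ : (Fin n → PName.{u, v} P) → Form (PName.{u, v} P)}
    (c : Fin n → PName.{u, v} P) (h : Forces p (φ c)) : Forces p (exs n φ) := by
  induction n with
  | zero => rwa [Subsingleton.elim c Fin.elim0] at h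
  | succ n ih =>
    refine forces_ex_of (c 0) (ih (Fin.tail c) ?_)
    rwa [← Fin.cons_self_tail c] at h

/-! ### Basic notions -/

theorem Forces.isSubset_congr {a a' b : PName.{u, v} P} (h : Forces p (a ≐ a'))
    (ha : Forces p (isSubset a b)) : Forces p (isSubset a' b) := fun z =>
  forces_imp.2 fun q hq hz =>
    forces_imp.1 (ha z) q hq ((h.mono hq).symm.mem_congr_right hz)

theorem forces_eq_of_isEmpty {e e' : PName.{u, v} P} (h : Forces p (isEmpty e))
    (h' : Forces p (isEmpty e')) : Forces p (e ≐ e') :=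
  forces_eq_of_mem_iff fun z q hq => iff_of_false (h z q hq) (h' z q hq)

theorem forces_eq_of_isSucc {s s' y y' : PName.{u, v} P} (h : Forces p (isSucc s y))
    (h' : Forces p (isSucc s' y')) (hy : Forces p (y ≐ y')) : Forces p (s ≐ s') := by
  refine forces_eq_of_mem_iff fun z q hq => ?_
  rw [forces_iff.1 (h z) q hq, forces_iff.1 (h' z) q hq, forces_or, forces_or]
  refine forall₂_congr fun r hr => exists_congr fun t => and_congr_right fun ht => ?_
  have hy := hy.mono (ht.trans (hr.trans hq))
  exact or_congr ⟨hy.mem_congr_right, hy.symm.mem_congr_right⟩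
    ⟨fun h => h.trans hy, fun h => h.trans hy.symm⟩

end Basic

/-! ## Names for natural numbers and for sets of natural numbers -/

section Names

variable {P : Type u} [Preorder P] [OrderTop P] {p q : P}

variable (P) in
/-- The canonical name of the von Neumann numeral `n`. -/
def natName (n : ℕ) : PName.{u, v} P :=
  .mk (ULift (Fin n)) (fun i => natName i.down.1) fun _ => ⊤
termination_by n
decreasing_by exact i.down.2

variable (P) in
/-- The canonical name of a set of natural numbers of the ground model. -/
def setName (A : Set ℕ) : PName.{u, v} P :=
  .mk (ULift A) (fun i => natName P i.down.1) fun _ => ⊤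

theorem forces_mem_natName {z : PName.{u, v} P} {n : ℕ} :
    Forces p (z ∊ natName P n) ↔ ∀ q ≤ p, ∃ r ≤ q, ∃ m < n, Forces r (z ≐ natName P m) := by
  rw [natName, forces_mem_mk]
  refine forall₂_congr fun q _ => exists_congr fun r => and_congr_right fun _ => ?_
  exact ⟨fun ⟨j, _, h⟩ => ⟨j.down, j.down.2, h⟩, fun ⟨m, hm, h⟩ => ⟨⟨⟨m, hm⟩⟩, le_top, h⟩⟩

theorem forces_mem_setName {z : PName.{u, v} P} {A : Set ℕ} :
    Forces p (z ∊ setName P A) ↔ ∀ q ≤ p, ∃ r ≤ q, ∃ m ∈ A, Forces r (z ≐ natName P m) := by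
  rw [setName, forces_mem_mk]
  refine forall₂_congr fun q _ => exists_congr fun r => and_congr_right fun _ => ?_
  exact ⟨fun ⟨j, _, h⟩ => ⟨j.down, j.down.2, h⟩, fun ⟨m, hm, h⟩ => ⟨⟨⟨m, hm⟩⟩, le_top, h⟩⟩

theorem forces_natName_mem_natName {m n : ℕ} (h : m < n) :
    Forces p ((natName P m : PName.{u, v} P) ∊ natName P n) :=
  forces_mem_natName.2 fun q _ => ⟨q, le_rfl, m, h, forces_eq_refl _ _⟩

theorem forces_natName_eq {m n : ℕ} :
    Forces p ((natName P m : PName.{u, v} P) ≐ natName P n) ↔ m = n := by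
  refine ⟨fun h => ?_, fun h => h ▸ forces_eq_refl _ _⟩
  rcases lt_trichotomy m n with hmn | hmn | hmn
  · exact (not_forces_mem_self _ _ (h.symm.mem_congr_right (forces_natName_mem_natName hmn))).elim
  · exact hmn
  · exact (not_forces_mem_self _ _ (h.mem_congr_right (forces_natName_mem_natName hmn))).elim

theorem forces_natName_mem_setName {n : ℕ} {A : Set ℕ} :
    Forces p ((natName P n : PName.{u, v} P) ∊ setName P A) ↔ n ∈ A := by
  refine ⟨fun h => ?_,
    fun h => forces_mem_setName.2 fun q _ => ⟨q, le_rfl, n, h, forces_eq_refl _ _⟩⟩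
  obtain ⟨r, _, m, hm, h⟩ := forces_mem_setName.1 h p le_rfl
  exact forces_natName_eq.1 h ▸ hm

theorem Forces.natName_mem_iff {a : PName.{u, v} P} {A : Set ℕ}
    (h : Forces p (a ≐ setName P A)) (n : ℕ) : Forces p (natName P n ∊ a) ↔ n ∈ A :=
  ⟨fun hn => forces_natName_mem_setName.1 (h.mem_congr_right hn),
    fun hn => h.symm.mem_congr_right (forces_natName_mem_setName.2 hn)⟩

theorem forces_setName_isSubset {A B : Set ℕ} (h : A ⊆ B) :
    Forces p (isSubset (setName.{u, v} P A) (setName P B)) := by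
  refine fun z => forces_imp.2 fun q _ hz => forces_mem_setName.2 fun r hr => ?_
  obtain ⟨s, hs, m, hm, hf⟩ := forces_mem_setName.1 hz r hr
  exact ⟨s, hs, m, h hm, hf⟩

theorem forces_isEmpty_natName_zero : Forces p (isEmpty (natName.{u, v} P 0)) := by
  intro z q _ hz
  obtain ⟨r, _, m, hm, _⟩ := forces_mem_natName.1 hz q le_rfl
  exact absurd hm (Nat.not_lt_zero m)

theorem forces_isSucc_natName {y : PName.{u, v} P} {n : ℕ} (h : Forces p (y ≐ natName P n)) :
    Forces p (isSucc (natName P (n + 1)) y) := by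
  intro z
  refine forces_iff.2 fun q hq => ⟨fun hz => forces_or.2 fun r hr => ?_,
    fun hz => forces_mem_natName.2 fun r hr => ?_⟩
  · obtain ⟨s, hs, m, hm, hf⟩ := forces_mem_natName.1 hz r hr
    refine ⟨s, hs, ?_⟩
    have hy := h.mono (hs.trans (hr.trans hq))
    rcases (Nat.lt_succ_iff_lt_or_eq.1 hm) with hm | rfl
    · exact Or.inl (hf.symm.mem_congr_left (hy.symm.mem_congr_right
        (forces_natName_mem_natName hm)))
    · exact Or.inr (hf.trans hy.symm)
  · obtain ⟨s, hs, hf⟩ := forces_or.1 hz r hr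
    have hy := h.mono (hs.trans (hr.trans hq))
    rcases hf with hf | hf
    · obtain ⟨t, ht, m, hm, hf⟩ := forces_mem_natName.1 (hy.mem_congr_right hf) s le_rfl
      exact ⟨t, ht.trans hs, m, hm.trans n.lt_succ_self, hf⟩
    · exact ⟨s, hs, n, n.lt_succ_self, hf.trans hy⟩

variable (P) in
/-- The canonical name of `ω`. -/
abbrev omegaName : PName.{u, v} P := setName P Set.univ

theorem forces_isInductiveSet_omegaName : Forces p (isInductiveSet (omegaName.{u, v} P)) := by
  refine ⟨forces_ex_of (natName P 0) ⟨forces_isEmpty_natName_zero,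
    forces_natName_mem_setName.2 trivial⟩, fun y => forces_imp.2 fun q _ hy => ?_⟩
  refine forces_of_dense fun r hr => ?_
  obtain ⟨s, hs, n, _, hf⟩ := forces_mem_setName.1 hy r hr
  exact ⟨s, hs, forces_ex_of (natName P (n + 1))
    ⟨forces_isSucc_natName hf, forces_natName_mem_setName.2 trivial⟩⟩

theorem Forces.natName_mem_of_isInductiveSet {I : PName.{u, v} P}
    (h : Forces p (isInductiveSet I)) (n : ℕ) : Forces p (natName P n ∊ I) := by
  induction n with
  | zero =>
    refine forces_of_dense fun q hq => ?_
    obtain ⟨r, hr, e, he, hI⟩ := forces_ex.1 h.1 q hq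
    exact ⟨r, hr, (forces_eq_of_isEmpty he forces_isEmpty_natName_zero).mem_congr_left hI⟩
  | succ n ih =>
    refine forces_of_dense fun q hq => ?_
    obtain ⟨r, hr, s, hs, hI⟩ := forces_ex.1 (forces_imp.1 (h.2 (natName P n)) p le_rfl ih) q hq
    exact ⟨r, hr, (forces_eq_of_isSucc hs (forces_isSucc_natName (forces_eq_refl _ _))
      (forces_eq_refl _ _)).mem_congr_left hI⟩

theorem forces_isOmega : Forces p (isOmega (omegaName.{u, v} P)) := by
  refine fun z => forces_iff.2 fun q _ => ⟨fun hz I => forces_imp.2 fun r hr hI => ?_, fun h => ?_⟩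
  · refine forces_of_dense fun s hs => ?_
    obtain ⟨t, ht, n, _, hf⟩ := forces_mem_setName.1 hz s (hs.trans hr)
    exact ⟨t, ht, hf.symm.mem_congr_left
      ((hI.mono (ht.trans hs)).natName_mem_of_isInductiveSet n)⟩
  · exact forces_imp.1 (h (omegaName P)) q le_rfl forces_isInductiveSet_omegaName

/-! ### No new subsets of `ω` -/

/-- Every decreasing sequence of conditions has a lower bound. -/
def SigmaClosed (P : Type u) [Preorder P] : Prop :=
  ∀ f : ℕ → P, Antitone f → ∃ q, ∀ n, q ≤ f n

/-- A descending sequence decides the statements `n ∈ a` one at a time; a lower bound decides them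
all, so the resulting set is definable in the ground model. -/
theorem exists_forces_eq_setName (hσ : SigmaClosed P) {a : PName.{u, v} P}
    (ha : Forces p (isSubset a (omegaName P))) :
    ∃ q ≤ p, ∃ A, Forces q (a ≐ setName P A) := by
  choose g hg hd using fun (n : ℕ) (r : P) => exists_decides r (natName.{u, v} P n ∊ a)
  -- Start at `p`; the decision about `n` is made in passing to `f (n + 1)`.
  let f : ℕ → P := fun n => Nat.rec p g n
  have hf : Antitone f := antitone_nat_of_succ_le fun n => hg n (f n)
  obtain ⟨q, hq⟩ := hσ f hf
  have hqp : q ≤ p := hq 0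
  have hdec : ∀ n, Forces q (natName P n ∊ a) ∨ Forces q (∼(natName P n ∊ a)) := fun n =>
    (hd n (f n)).imp (fun h => h.mono (hq (n + 1))) (fun h => h.mono (hq (n + 1)))
  refine ⟨q, hqp, {n | Forces q (natName P n ∊ a)}, forces_eq_of_mem_iff fun z r hr => ?_⟩
  rw [forces_mem_setName]
  refine ⟨fun hz s hs => ?_, fun h => forces_of_dense fun s hs => ?_⟩
  · have hω := forces_imp.1 (ha z) r (hr.trans hqp) hz
    obtain ⟨t, ht, n, _, hf⟩ := forces_mem_setName.1 hω s hs
    refine ⟨t, ht, n, (hdec n).resolve_right fun hn => ?_, hf⟩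
    exact hn t (ht.trans (hs.trans hr)) (hf.mem_congr_left (hz.mono (ht.trans hs)))
  · obtain ⟨t, ht, n, hn, hf⟩ := h s hs
    exact ⟨t, ht, hf.symm.mem_congr_left (Forces.mono hn (ht.trans (hs.trans hr)))⟩

end Names

/-! ## Points, open sets and closed sets of `ω*` -/

section Points

variable {P : Type} [Preorder P] [OrderTop P] {p q : P}

/-- The name of a family of sets of natural numbers of the ground model: `A` belongs to it when
`(A, t) ∈ S` for some `t` in the generic filter. -/
def familyName (S : Set (Set ℕ × P)) : PName.{0, v} P :=
  .mk (ULift S) (fun a => setName P a.down.1.1) fun a => a.down.1.2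

theorem forces_mem_familyName {z : PName.{0, v} P} {S : Set (Set ℕ × P)} :
    Forces p (z ∊ familyName S) ↔
      ∀ q ≤ p, ∃ r ≤ q, ∃ A t, (A, t) ∈ S ∧ r ≤ t ∧ Forces r (z ≐ setName P A) := by
  rw [familyName, forces_mem_mk]
  refine forall₂_congr fun q _ => exists_congr fun r => and_congr_right fun _ => ?_
  exact ⟨fun ⟨⟨⟨(A, t), hS⟩⟩, ht, h⟩ => ⟨A, t, hS, ht, h⟩,
    fun ⟨A, t, hS, ht, h⟩ => ⟨⟨⟨(A, t), hS⟩⟩, ht, h⟩⟩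

theorem forces_setName_eq {A B : Set ℕ} :
    Forces p ((setName P A : PName.{0, v} P) ≐ setName P B) ↔ A = B := by
  refine ⟨fun h => Set.ext fun n => ?_, fun h => h ▸ forces_eq_refl _ _⟩
  rw [← forces_natName_mem_setName (p := p), h.natName_mem_iff]

theorem forces_setName_mem_familyName {A : Set ℕ} {S : Set (Set ℕ × P)} :
    Forces p ((setName P A : PName.{0, v} P) ∊ familyName S) ↔
      ∀ q ≤ p, ∃ r ≤ q, ∃ t, (A, t) ∈ S ∧ r ≤ t := by
  rw [forces_mem_familyName]
  refine forall₂_congr fun q _ => exists_congr fun r => and_congr_right fun _ => ?_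
  constructor
  · rintro ⟨B, t, hS, ht, h⟩
    rw [forces_setName_eq.1 h]
    exact ⟨t, hS, ht⟩
  · rintro ⟨t, hS, ht⟩
    exact ⟨A, t, hS, ht, forces_eq_refl _ _⟩

/-- The semantic description of `p ⊩ x ∈ ω*`: the condition `p` forces the elements of `x` to be
sets of the ground model, each `q ≤ p` forces the sets of some free filter into `x`, and each set
of the ground model is decided. -/
structure PointAt (p : P) (x : PName.{0, v} P) : Prop where
  exists_eq : ∀ q ≤ p, ∀ a, Forces q (a ∊ x) → ∃ r ≤ q, ∃ A, Forces r (a ≐ setName P A)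
  exists_filter : ∀ q ≤ p, ∃ F : Filter ℕ, F.NeBot ∧ F ≤ Filter.cofinite ∧
    ∀ A, A ∈ F ↔ Forces q (setName P A ∊ x)
  decides : ∀ q ≤ p, ∀ A, ∃ r ≤ q, Forces r (setName P A ∊ x) ∨ Forces r (setName P Aᶜ ∊ x)

namespace PointAt

variable {x y : PName.{0, v} P}

theorem mono (h : PointAt p x) (hq : q ≤ p) : PointAt q x :=
  ⟨fun r hr => h.1 r (hr.trans hq), fun r hr => h.2 r (hr.trans hq),
    fun r hr => h.3 r (hr.trans hq)⟩

theorem univ_mem (h : PointAt p x) : Forces p (setName P Set.univ ∊ x) := by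
  obtain ⟨F, _, _, hF⟩ := h.exists_filter p le_rfl
  exact (hF _).1 Filter.univ_mem

theorem infinite_of_mem (h : PointAt p x) {A : Set ℕ} (hA : Forces p (setName P A ∊ x)) :
    A.Infinite := by
  obtain ⟨F, hne, hle, hF⟩ := h.exists_filter p le_rfl
  intro hfin
  have h₁ : Aᶜ ∈ F := hle hfin.compl_mem_cofinite
  have h₂ := Filter.inter_mem ((hF A).2 hA) h₁
  rw [Set.inter_compl_self] at h₂
  exact hne.ne (Filter.empty_mem_iff_bot.1 h₂)

theorem inter_mem (h : PointAt p x) {A B : Set ℕ} (hA : Forces p (setName P A ∊ x))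
    (hB : Forces p (setName P B ∊ x)) : Forces p (setName P (A ∩ B) ∊ x) := by
  obtain ⟨F, _, _, hF⟩ := h.exists_filter p le_rfl
  exact (hF _).1 (Filter.inter_mem ((hF A).2 hA) ((hF B).2 hB))

theorem mem_of_finite_diff (h : PointAt p x) {A B : Set ℕ} (hA : Forces p (setName P A ∊ x))
    (hB : (A \ B).Finite) : Forces p (setName P B ∊ x) := by
  obtain ⟨F, _, hle, hF⟩ := h.exists_filter p le_rfl
  refine (hF _).1 (Filter.mem_of_superset
    (Filter.inter_mem ((hF A).2 hA) (hle hB.compl_mem_cofinite)) ?_)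
  rintro n ⟨hn, hn'⟩
  by_contra hc
  exact hn' ⟨hn, hc⟩

end PointAt

/-- The axioms of a point are tested on names of ground model sets. The sets forced into `x` by one
condition form only a filter, since deciding a set may need a stronger condition; hence the separate
clauses of `PointAt`. -/
theorem pointAt_of_forces (hσ : SigmaClosed P) {x : PName.{0, v} P}
    (h : Forces p (isPoint (omegaName P) x)) : PointAt p x := by
  obtain ⟨h₁, h₂, h₃, h₄, h₅, h₆, h₇⟩ := h
  have sub : ∀ A : Set ℕ, ∀ q : P, Forces q (isSubset (setName.{0, v} P A) (omegaName P)) :=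
    fun A q => forces_setName_isSubset (Set.subset_univ A)
  have inter : ∀ q ≤ p, ∀ A B : Set ℕ, Forces q (setName P A ∊ x) → Forces q (setName P B ∊ x) →
      Forces q (setName P (A ∩ B) ∊ x) := by
    intro q hq A B hA hB
    refine forces_imp.1 (forces_imp.1 (forces_imp.1 (h₅ (setName P A) (setName P B)
      (setName P (A ∩ B))) q hq hA) q le_rfl hB) q le_rfl fun z => forces_iff.2 fun r _ => ?_
    refine ⟨fun hz => ⟨forces_imp.1 (forces_setName_isSubset Set.inter_subset_left z) r le_rfl hz,
      forces_imp.1 (forces_setName_isSubset Set.inter_subset_right z) r le_rfl hz⟩, fun hz => ?_⟩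
    refine forces_mem_setName.2 fun s hs => ?_
    obtain ⟨t, ht, n, hn, hf⟩ := forces_mem_setName.1 hz.1 s hs
    refine ⟨t, ht, n, ⟨hn, ?_⟩, hf⟩
    exact forces_natName_mem_setName.1 (hf.mem_congr_left (hz.2.mono (ht.trans hs)))
  have up : ∀ q ≤ p, ∀ A B : Set ℕ, Forces q (setName P A ∊ x) → A ⊆ B →
      Forces q (setName P B ∊ x) := fun q hq A B hA hAB =>
    forces_imp.1 (forces_imp.1 (forces_imp.1 (h₄ (setName P A) (setName P B)) q hq hA) q le_rfl
      (forces_setName_isSubset hAB)) q le_rfl (sub B q)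
  have compl : ∀ q ≤ p, ∀ A : Set ℕ, ∃ r ≤ q, Forces r (setName P A ∊ x) ∨
      Forces r (setName P Aᶜ ∊ x) := by
    intro q hq A
    refine forces_or.1 (forces_imp.1 (forces_imp.1 (h₆ (setName P A) (setName P Aᶜ)) q hq
      (sub A q)) q le_rfl fun z => forces_iff.2 fun r _ => ⟨fun hz => ⟨?_, ?_⟩, fun hz => ?_⟩) q
      le_rfl
    · exact forces_imp.1 (sub Aᶜ r z) r le_rfl hz
    · intro s hs hA
      obtain ⟨t, ht, n, hn, hf⟩ := forces_mem_setName.1 hz s hs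
      exact hn (forces_natName_mem_setName.1 (hf.mem_congr_left (hA.mono ht)))
    · refine forces_mem_setName.2 fun s hs => ?_
      obtain ⟨t, ht, n, _, hf⟩ := forces_mem_setName.1 hz.1 s hs
      refine ⟨t, ht, n, fun hn => ?_, hf⟩
      exact hz.2 t (ht.trans hs) (hf.symm.mem_congr_left (forces_natName_mem_setName.2 hn))
  have empty : ∀ q ≤ p, ¬ Forces q (setName P ∅ ∊ x) := fun q hq hq' =>
    forces_imp.1 (h₃ (setName P ∅)) q hq (fun z r _ hz => by
      obtain ⟨_, _, m, hm, _⟩ := forces_mem_setName.1 hz r le_rfl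
      exact hm) q le_rfl hq'
  have single : ∀ q ≤ p, ∀ n : ℕ, ¬ Forces q (setName P {n} ∊ x) := by
    intro q hq n hq'
    refine forces_imp.1 (forces_imp.1 (h₇ (natName P n) (setName P {n})) q hq
      (forces_natName_mem_setName.2 trivial)) q le_rfl
      (fun z => forces_iff.2 fun r _ => ⟨fun hz => forces_of_dense fun s hs => ?_, fun hz => ?_⟩)
      q le_rfl hq'
    · obtain ⟨t, ht, m, rfl, hf⟩ := forces_mem_setName.1 hz s hs
      exact ⟨t, ht, hf⟩
    · exact hz.symm.mem_congr_left (forces_natName_mem_setName.2 rfl)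
  refine ⟨fun q hq a ha => ?_, fun q hq => ?_, compl⟩
  · exact exists_forces_eq_setName hσ (forces_imp.1 (h₁ a) q hq ha)
  · refine ⟨⟨{A | Forces q (setName P A ∊ x)}, h₂.mono hq, fun hA => up q hq _ _ hA,
      fun hA => inter q hq _ _ hA⟩, ⟨fun hb => empty q hq ?_⟩, ?_, fun A => Iff.rfl⟩
    · exact (Filter.empty_mem_iff_bot.2 hb : ∅ ∈ _)
    · refine Filter.le_cofinite_iff_compl_singleton_mem.2 fun n => ?_
      refine forces_of_dense fun r hr => ?_
      -- Decide `{n}`; freeness rules out the alternative that it belongs to `x`.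
      obtain ⟨s, hs, hf⟩ := compl r (hr.trans hq) {n}
      exact ⟨s, hs, hf.resolve_left (single s (hs.trans (hr.trans hq)) n)⟩

/-- Each axiom is checked on a dense set of conditions at which the names involved are identified
with ground model sets. -/
theorem PointAt.forces (hσ : SigmaClosed P) {x : PName.{0, v} P} (h : PointAt p x) :
    Forces p (isPoint (omegaName P) x) := by
  refine ⟨fun a => forces_imp.2 fun q hq ha => ?_, h.univ_mem, fun e => forces_imp.2
    fun q hq he r hr hex => ?_, fun a b => forces_imp.2 fun q hq ha => forces_imp.2 fun r hr hab =>
    forces_imp.2 fun s hs hb => forces_of_dense fun t ht => ?_, fun a b c => forces_imp.2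
    fun q hq ha => forces_imp.2 fun r hr hb => forces_imp.2 fun s hs hc =>
    forces_of_dense fun t ht => ?_, fun a b => forces_imp.2 fun q hq ha => forces_imp.2
    fun r hr hb => forces_or.2 fun s hs => ?_, fun n s => forces_imp.2 fun q hq hn => forces_imp.2
    fun r hr hs t ht hx => ?_⟩
  · refine forces_of_dense fun r hr => ?_
    obtain ⟨s, hs, A, hA⟩ := h.exists_eq r (hr.trans hq) a (ha.mono hr)
    exact ⟨s, hs, hA.symm.isSubset_congr (forces_setName_isSubset (Set.subset_univ A))⟩
  · obtain ⟨s, hs, A, hA⟩ := h.exists_eq r (hr.trans hq) e hex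
    have := (h.mono (hs.trans (hr.trans hq))).infinite_of_mem (hA.mem_congr_left (hex.mono hs))
    obtain ⟨n, hn⟩ := this.nonempty
    exact he _ s (hs.trans hr) ((hA.natName_mem_iff n).2 hn)
  · have htq : t ≤ q := ht.trans (hs.trans hr)
    obtain ⟨w, hw, A, hA⟩ := h.exists_eq t (htq.trans hq) a (ha.mono htq)
    -- Here `b` is not yet known to belong to `x`, so countable closure has to identify it.
    obtain ⟨w', hw', B, hB⟩ := exists_forces_eq_setName hσ (hb.mono (hw.trans ht))
    have hA := hA.mono hw'
    refine ⟨w', hw'.trans hw, hB.symm.mem_congr_left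
      ((h.mono (hw'.trans (hw.trans (htq.trans hq)))).mem_of_finite_diff
      (hA.mem_congr_left (ha.mono (hw'.trans (hw.trans htq)))) (B := B) ?_)⟩
    rw [Set.sdiff_eq_empty.2]
    · exact Set.finite_empty
    · exact fun n hn => (hB.natName_mem_iff n).1 (forces_imp.1 (hab (natName P n)) w'
        (hw'.trans (hw.trans (ht.trans hs))) ((hA.natName_mem_iff n).2 hn))
  · have htr : t ≤ r := ht.trans hs
    have htq : t ≤ q := htr.trans hr
    obtain ⟨w, hw, A, hA⟩ := h.exists_eq t (htq.trans hq) a (ha.mono htq)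
    obtain ⟨w', hw', B, hB⟩ := h.exists_eq w (hw.trans (htq.trans hq)) b
      (hb.mono (hw.trans htr))
    have hwt := hw'.trans hw
    have hA := hA.mono hw'
    refine ⟨w', hwt, Forces.mem_congr_left ?_
      ((h.mono (hwt.trans (htq.trans hq))).inter_mem
      (hA.mem_congr_left (ha.mono (hwt.trans htq))) (hB.mem_congr_left (hb.mono (hwt.trans htr))))⟩
    refine forces_eq_of_mem_iff fun z v hv => ?_
    rw [forces_iff.1 (hc z) v (hv.trans (hwt.trans ht)), forces_and]
    have hA := hA.mono hv
    have hB := hB.mono hv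
    refine ⟨fun hz => ⟨hA.symm.mem_congr_right
      (forces_imp.1 (forces_setName_isSubset Set.inter_subset_left z) v le_rfl hz),
      hB.symm.mem_congr_right
      (forces_imp.1 (forces_setName_isSubset Set.inter_subset_right z) v le_rfl hz)⟩,
      fun hz => forces_mem_setName.2 fun v' hv' => ?_⟩
    obtain ⟨v'', hv'', n, hn, hf⟩ := forces_mem_setName.1 (hA.mem_congr_right hz.1) v' hv'
    exact ⟨v'', hv'', n, ⟨hn, ((hB.mono (hv''.trans hv')).natName_mem_iff n).1
      (hf.mem_congr_left (hz.2.mono (hv''.trans hv')))⟩, hf⟩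
  · have hsq := hs.trans hr
    obtain ⟨t, ht, A, hA⟩ := exists_forces_eq_setName hσ (ha.mono hsq)
    have hbs : Forces t (b ≐ setName P Aᶜ) := by
      refine forces_eq_of_mem_iff fun z w hw => ?_
      have hA := hA.mono hw
      rw [forces_iff.1 (hb z) w (hw.trans (ht.trans hs)), forces_and]
      refine ⟨fun hz => forces_mem_setName.2 fun w' hw' => ?_,
        fun hz => ⟨forces_mem_setName.2 fun w' hw' => ?_,
        fun w' hw' hza => ?_⟩⟩
      · obtain ⟨w'', hw'', n, _, hf⟩ := forces_mem_setName.1 hz.1 w' hw'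
        exact ⟨w'', hw'', n, fun hn => hz.2 w'' (hw''.trans hw') (hf.symm.mem_congr_left
          (((hA.mono (hw''.trans hw')).natName_mem_iff n).2 hn)), hf⟩
      · obtain ⟨w'', hw'', n, _, hf⟩ := forces_mem_setName.1 hz w' hw'
        exact ⟨w'', hw'', n, trivial, hf⟩
      · obtain ⟨w'', hw'', n, hn, hf⟩ := forces_mem_setName.1 (hz.mono hw') w' le_rfl
        exact hn (((hA.mono (hw''.trans hw')).natName_mem_iff n).1
          (hf.mem_congr_left (hza.mono hw'')))
    obtain ⟨w, hw, hf⟩ := h.decides t (ht.trans (hsq.trans hq)) A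
    exact ⟨w, hw.trans ht, hf.imp (hA.symm.mono hw).mem_congr_left
      (hbs.symm.mono hw).mem_congr_left⟩
  · have htq := ht.trans hr
    obtain ⟨w, hw, m, _, hm⟩ := forces_mem_setName.1 hn t htq
    have hw' := hw.trans (ht.trans (hr.trans hq))
    refine (h.mono hw').infinite_of_mem (A := {m})
      (Forces.mem_congr_left (forces_eq_of_mem_iff fun z v hv => ?_) (hx.mono hw))
      (Set.finite_singleton m)
    have hm := hm.mono hv
    rw [forces_iff.1 (hs z) v (hv.trans (hw.trans ht)), forces_mem_setName]
    refine ⟨fun hz v' hv' => ⟨v', le_rfl, m, rfl, (hz.trans hm).mono hv'⟩,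
      fun hz => forces_of_dense fun v' hv' => ?_⟩
    obtain ⟨v'', hv'', _, rfl, hf⟩ := hz v' hv'
    exact ⟨v'', hv'', hf.trans (hm.mono (hv''.trans hv')).symm⟩

theorem forces_isPoint_iff (hσ : SigmaClosed P) {x : PName.{0, v} P} :
    Forces p (isPoint (omegaName P) x) ↔ PointAt p x :=
  ⟨pointAt_of_forces hσ, PointAt.forces hσ⟩

end Points

/-! ### Names for open and closed sets of points -/

section Topology

section

variable {P : Type} [Preorder P]

/-- The property `φ` respects the equality of names. -/
def Congruent (φ : PName.{0, v} P → Form (PName.{0, v} P)) : Prop :=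
  ∀ ⦃p x y⦄, Forces p (x ≐ y) → Forces p (φ x) → Forces p (φ y)

theorem Congruent.neg {φ : PName.{0, v} P → Form (PName.{0, v} P)} (h : Congruent φ) :
    Congruent fun y => ∼(φ y) :=
  fun _ _ _ hxy hx q hq hy => hx q hq (h (hxy.mono hq).symm hy)

end

variable {P : Type} [Preorder P] [OrderTop P] {p q : P} {x y : PName.{0, v} P}

theorem PointAt.congr (h : PointAt p x) (hxy : Forces p (x ≐ y)) : PointAt p y where
  exists_eq q hq a ha := h.exists_eq q hq a ((hxy.mono hq).symm.mem_congr_right ha)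
  exists_filter q hq := by
    obtain ⟨F, hne, hle, hF⟩ := h.exists_filter q hq
    exact ⟨F, hne, hle, fun A => (hF A).trans
      ⟨(hxy.mono hq).mem_congr_right, (hxy.mono hq).symm.mem_congr_right⟩⟩
  decides q hq A := by
    obtain ⟨r, hr, hf⟩ := h.decides q hq A
    have := hxy.mono (hr.trans hq)
    exact ⟨r, hr, hf.imp this.mem_congr_right this.mem_congr_right⟩

/-- Names of points form a proper class, but each is equivalent to one coded by a set of pairs `(A,
t)`. This lets `pointSet` be indexed by a small type and still contain every point. -/
theorem PointAt.exists_eq_familyName (h : PointAt p y) :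
    ∃ S : Set (Set ℕ × P), Forces p (y ≐ familyName S) := by
  refine ⟨{a | Forces a.2 (setName P a.1 ∊ y)}, forces_eq_of_mem_iff fun z q hq => ?_⟩
  rw [forces_mem_familyName]
  refine ⟨fun hz r hr => ?_, fun hz => forces_of_dense fun r hr => ?_⟩
  · obtain ⟨s, hs, A, hA⟩ := h.exists_eq r (hr.trans hq) z (hz.mono hr)
    exact ⟨s, hs, A, s, hA.mem_congr_left (hz.mono (hs.trans hr)), le_rfl, hA⟩
  · obtain ⟨s, hs, A, t, hS, ht, hf⟩ := hz r hr
    exact ⟨s, hs, hf.symm.mem_congr_left (Forces.mono hS ht)⟩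

/-- A name of the set of the points of `ω*` with the property `φ`. -/
def pointSet (φ : PName.{0, v} P → Form (PName.{0, v} P)) : PName.{0, v} P :=
  .mk (ULift {t : Set (Set ℕ × P) × P //
      PointAt t.2 (familyName.{v} t.1) ∧ Forces t.2 (φ (familyName t.1))})
    (fun t => familyName t.down.1.1) fun t => t.down.1.2

theorem forces_mem_pointSet (hσ : SigmaClosed P) {φ : PName.{0, v} P → Form (PName.{0, v} P)}
    (hφ : Congruent φ) :
    Forces p (y ∊ pointSet φ) ↔ PointAt p y ∧ Forces p (φ y) := by
  refine ⟨fun h => ?_, fun ⟨h, hf⟩ => ?_⟩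
  · rw [← forces_isPoint_iff hσ, ← forces_and]
    refine forces_of_dense fun q hq => ?_
    obtain ⟨r, hr, j, hj, hf⟩ := forces_mem_mk.1 h q hq
    obtain ⟨h₁, h₂⟩ := j.down.2
    exact ⟨r, hr, ((h₁.mono hj).congr hf.symm).forces hσ, hφ hf.symm (h₂.mono hj)⟩
  · obtain ⟨S, hS⟩ := h.exists_eq_familyName
    exact fun q hq => ⟨q, le_rfl, ⟨(S, q), (h.mono hq).congr (hS.mono hq),
      (hφ hS hf).mono hq⟩, le_rfl, hS.mono hq⟩

/-- The formula "some element of the family named by `S` belongs to `y`". -/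
def meets (S : Set (Set ℕ × P)) (y : PName.{0, v} P) : Form (PName.{0, v} P) :=
  .ex fun a => a ∊ familyName S ⩑ a ∊ y

theorem congruent_meets (S : Set (Set ℕ × P)) : Congruent (meets.{v} S) := by
  refine fun p x y hxy hx => forces_ex.2 fun q hq => ?_
  obtain ⟨r, hr, a, ha, hf⟩ := forces_ex.1 hx q hq
  exact ⟨r, hr, a, ha, (hxy.mono (hr.trans hq)).mem_congr_right hf⟩

theorem forces_meets {S : Set (Set ℕ × P)} :
    Forces p (meets S y) ↔
      ∀ q ≤ p, ∃ r ≤ q, ∃ A t, (A, t) ∈ S ∧ r ≤ t ∧ Forces r (setName P A ∊ y) := by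
  rw [meets, forces_ex]
  refine ⟨fun h q hq => ?_, fun h q hq => ?_⟩
  · obtain ⟨r, hr, a, ha, hf⟩ := h q hq
    obtain ⟨s, hs, A, t, hS, ht, hA⟩ := forces_mem_familyName.1 ha r le_rfl
    exact ⟨s, hs.trans hr, A, t, hS, ht, hA.mem_congr_left (hf.mono hs)⟩
  · obtain ⟨r, hr, A, t, hS, ht, hf⟩ := h q hq
    exact ⟨r, hr, setName P A, forces_setName_mem_familyName.2
      fun s hs => ⟨s, le_rfl, t, hS, hs.trans ht⟩, hf⟩

theorem forces_isOpenSet_meets (hσ : SigmaClosed P) (S : Set (Set ℕ × P)) :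
    Forces p (isOpenSet (omegaName P) (pointSet (meets.{v} S))) := by
  refine ⟨fun y => forces_imp.2 fun q _ hy => ?_, fun y => forces_imp.2 fun q _ hy => ?_⟩
  · exact ((forces_mem_pointSet hσ (congruent_meets S)).1 hy).1.forces hσ
  · have hm := ((forces_mem_pointSet hσ (congruent_meets S)).1 hy).2
    refine forces_ex.2 fun r hr => ?_
    obtain ⟨s, hs, a, ha, hf⟩ := forces_ex.1 hm r hr
    refine ⟨s, hs, a, hf, fun z => forces_imp.2 fun t ht hz => forces_imp.2 fun w hw haz => ?_⟩
    exact (forces_mem_pointSet hσ (congruent_meets S)).2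
      ⟨(pointAt_of_forces hσ hz).mono hw, forces_ex_of a ⟨ha.mono (hw.trans ht), haz⟩⟩

theorem forces_isClosedSet_meets (hσ : SigmaClosed P) (S : Set (Set ℕ × P)) :
    Forces p (isClosedSet (omegaName P) (pointSet fun y => ∼(meets.{v} S y))) := by
  have hS := congruent_meets.{v} S
  refine ⟨fun y => forces_imp.2 fun q _ hy => ?_, forces_ex_of (pointSet (meets S))
    ⟨forces_isOpenSet_meets hσ S, fun y => forces_imp.2 fun q _ hy => forces_iff.2 fun r hr => ?_⟩⟩
  · exact ((forces_mem_pointSet hσ hS.neg).1 hy).1.forces hσ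
  · have hy := (pointAt_of_forces hσ hy).mono hr
    rw [forces_mem_pointSet hσ hS]
    refine ⟨fun h s hs hn => ?_, fun h => ⟨hy, forces_by_contra fun s hs hn => ?_⟩⟩
    · exact ((forces_mem_pointSet hσ hS.neg).1 hn).2 s le_rfl (h.2.mono hs)
    · exact h s hs ((forces_mem_pointSet hσ hS.neg).2 ⟨hy.mono hs, hn⟩)

/-- The name of an ultrafilter of the ground model. -/
def ultrafilterName (u : Ultrafilter ℕ) : PName.{0, v} P := familyName {a | a.1 ∈ u}

theorem forces_setName_mem_ultrafilterName {u : Ultrafilter ℕ} {A : Set ℕ} :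
    Forces p ((setName P A : PName.{0, v} P) ∊ ultrafilterName u) ↔ A ∈ u := by
  rw [ultrafilterName, forces_setName_mem_familyName]
  refine ⟨fun h => ?_, fun h q _ => ⟨q, le_rfl, q, h, le_rfl⟩⟩
  obtain ⟨_, _, _, h, _⟩ := h p le_rfl
  exact h

theorem exists_eq_of_mem_familyName {S : Set (Set ℕ × P)} {a : PName.{0, v} P}
    (h : Forces p (a ∊ familyName S)) : ∃ q ≤ p, ∃ A, Forces q (a ≐ setName P A) := by
  obtain ⟨r, hr, A, _, _, _, hf⟩ := forces_mem_familyName.1 h p le_rfl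
  exact ⟨r, hr, A, hf⟩

/-- `PointAt` only asks about ground model sets, and these are decided outright by `u`. -/
theorem pointAt_ultrafilterName (p : P) {u : Ultrafilter ℕ}
    (hu : (u : Filter ℕ) ≤ Filter.cofinite) :
    PointAt p (ultrafilterName.{v} u) where
  exists_eq _ _ _ ha := exists_eq_of_mem_familyName ha
  exists_filter _ _ := ⟨u, u.neBot, hu, fun _ => forces_setName_mem_ultrafilterName.symm⟩
  decides q _ A := ⟨q, le_rfl, by
    rw [forces_setName_mem_ultrafilterName, forces_setName_mem_ultrafilterName]
    exact u.mem_or_compl_mem A⟩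

end Topology

/-! ## Generic tie-points -/

/-- A system of partial colourings of `ω`, indexed by a partial order `P`, that generates a
tie-point: stronger conditions extend the colouring up to finitely many places, it can be extended so that
the uncoloured places are almost contained in any given set or in its complement, and so that
any given colour is used infinitely often. -/
structure ColoringSystem {P : Type} [Preorder P] {κ : Type} (col : P → ℕ → Option κ) : Prop where
  almost_le : ∀ ⦃p q⦄, q ≤ p → {i | ∃ k, col p i = some k ∧ col q i ≠ some k}.Finite
  infinite_none : ∀ p, {i | col p i = none}.Infinite
  decides : ∀ p A, ∃ q ≤ p, ({i | col q i = none} \ A).Finite ∨ ({i | col q i = none} \ Aᶜ).Finite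
  exists_some : ∀ p k, ∃ q ≤ p, {i | col p i = none ∧ col q i = some k}.Infinite

namespace ColoringSystem

section

variable {P : Type} [Preorder P] {p q : P} {κ : Type} {col : P → ℕ → Option κ}

variable (col) in
/-- The places that get a colour in `s`. -/
def colored (s : Set κ) (p : P) : Set ℕ := {i | ∃ k ∈ s, col p i = some k}

variable (hc : ColoringSystem col)

include hc

theorem finite_none_diff (h : q ≤ p) : ({i | col q i = none} \ {i | col p i = none}).Finite := by
  refine (hc.almost_le h).subset fun i ⟨hq, hp⟩ => ?_
  obtain ⟨k, hk⟩ := Option.ne_none_iff_exists'.1 hp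
  refine ⟨k, hk, fun hk' => ?_⟩
  rw [Set.mem_ofPred_eq, hk'] at hq
  cases hq

theorem finite_colored_diff (s : Set κ) (h : q ≤ p) :
    (colored col s p \ colored col s q).Finite := by
  refine (hc.almost_le h).subset ?_
  rintro i ⟨⟨k, hks, hk⟩, hi⟩
  exact ⟨k, hk, fun hk' => hi ⟨k, hks, hk'⟩⟩

end

variable {P : Type} [Preorder P] [OrderTop P] {p q : P} {y : PName.{0, v} P} {κ : Type}
  {col : P → ℕ → Option κ}

variable (col) in
/-- The generic point: it contains the sets of uncoloured places of the generic conditions. -/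
def genericPoint : PName.{0, v} P := familyName {a | ({i | col a.2 i = none} \ a.1).Finite}

variable (col) in
/-- The formula "`y` contains the set of places with a colour in `s` of a generic condition". -/
def meetsColor (s : Set κ) : PName.{0, v} P → Form (PName.{0, v} P) :=
  meets {a | a.1 = colored col s a.2}

variable (hc : ColoringSystem col)

include hc

theorem forces_mem_genericPoint {A : Set ℕ} :
    Forces p (setName P A ∊ genericPoint.{v} col) ↔
      ∀ q ≤ p, ∃ r ≤ q, ({i | col r i = none} \ A).Finite := by
  rw [genericPoint, forces_setName_mem_familyName]
  refine forall₂_congr fun q _ => exists_congr fun r => and_congr_right fun _ =>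
    ⟨fun ⟨t, ht, hr⟩ => ?_, fun h => ⟨r, h, le_rfl⟩⟩
  refine (ht.union (hc.finite_none_diff hr)).subset fun i ⟨hi, hA⟩ => ?_
  by_cases h : col t i = none
  · exact Or.inl ⟨h, hA⟩
  · exact Or.inr ⟨hi, h⟩

theorem forces_mem_genericPoint_of_finite {A : Set ℕ} (h : ({i | col p i = none} \ A).Finite) :
    Forces p (setName P A ∊ genericPoint.{v} col) := by
  refine hc.forces_mem_genericPoint.2 fun q hq => ⟨q, le_rfl, ?_⟩
  refine (h.union (hc.finite_none_diff hq)).subset fun i ⟨hi, hA⟩ => ?_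
  by_cases h : col p i = none
  · exact Or.inl ⟨h, hA⟩
  · exact Or.inr ⟨hi, h⟩

theorem pointAt_genericPoint (p : P) : PointAt p (genericPoint.{v} col) where
  exists_eq _ _ _ ha := exists_eq_of_mem_familyName ha
  exists_filter q _ := by
    refine ⟨⟨{A | Forces q (setName P A ∊ genericPoint.{v} col)}, ?_, ?_, ?_⟩, ⟨fun hb => ?_⟩, ?_,
      fun _ => Iff.rfl⟩
    · exact hc.forces_mem_genericPoint_of_finite (by simp)
    · intro A B hA hAB
      refine hc.forces_mem_genericPoint.2 fun r hr => ?_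
      obtain ⟨s, hs, hf⟩ := hc.forces_mem_genericPoint.1 hA r hr
      exact ⟨s, hs, hf.subset (Set.sdiff_subset_sdiff_right hAB)⟩
    · intro A B hA hB
      refine forces_of_dense fun r hr => ?_
      obtain ⟨s, hs, hf⟩ := hc.forces_mem_genericPoint.1 hA r hr
      obtain ⟨t, ht, hf'⟩ := hc.forces_mem_genericPoint.1 hB s (hs.trans hr)
      refine ⟨t, ht.trans hs, hc.forces_mem_genericPoint_of_finite ?_⟩
      rw [Set.sdiff_inter]
      refine Set.Finite.union ?_ hf'
      refine (hf.union (hc.finite_none_diff ht)).subset fun i ⟨hi, hA⟩ => ?_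
      by_cases h : col s i = none
      · exact Or.inl ⟨h, hA⟩
      · exact Or.inr ⟨hi, h⟩
    · obtain ⟨r, _, hf⟩ :=
        hc.forces_mem_genericPoint.1 (Filter.empty_mem_iff_bot.2 hb : ∅ ∈ _) q le_rfl
      rw [Set.sdiff_empty] at hf
      exact hc.infinite_none r hf
    · refine Filter.le_cofinite_iff_compl_singleton_mem.2 fun n => ?_
      refine hc.forces_mem_genericPoint_of_finite ((Set.finite_singleton n).subset ?_)
      rintro i ⟨_, hi⟩
      simpa using hi
  decides q _ A := by
    obtain ⟨r, hr, h⟩ := hc.decides q A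
    exact ⟨r, hr, h.imp hc.forces_mem_genericPoint_of_finite
      hc.forces_mem_genericPoint_of_finite⟩

/-- The coloured set in `y` may come from a weaker condition, but coloured sets only grow modulo
finite sets and points ignore finite sets. -/
theorem exists_colored_mem (hy : PointAt p y) {s : Set κ} (h : Forces p (meetsColor col s y)) :
    ∃ q ≤ p, Forces q (setName P (colored col s q) ∊ y) := by
  obtain ⟨r, hr, A, t, hA, ht, hf⟩ := forces_meets.1 h p le_rfl
  obtain rfl : A = colored col s t := Set.mem_ofPred.1 hA
  exact ⟨r, hr, (hy.mono hr).mem_of_finite_diff hf (hc.finite_colored_diff s ht)⟩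

omit hc in
theorem forces_meetsColor_of_dense {s : Set κ}
    (h : ∀ q ≤ p, ∃ r ≤ q, ∃ t, r ≤ t ∧ Forces r (setName P (colored col s t) ∊ y)) :
    Forces p (meetsColor col s y) := by
  refine forces_meets.2 fun q hq => ?_
  obtain ⟨r, hr, t, ht, hf⟩ := h q hq
  exact ⟨r, hr, _, t, Set.mem_ofPred.2 rfl, ht, hf⟩

theorem not_meetsColor_of_disjoint (hy : PointAt p y) {s t : Set κ} (hst : Disjoint s t)
    (hs : Forces p (meetsColor col s y)) : ¬ Forces p (meetsColor col t y) := by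
  intro ht
  obtain ⟨q, hq, h₁⟩ := hc.exists_colored_mem hy hs
  obtain ⟨r, hr, h₂⟩ := hc.exists_colored_mem (hy.mono hq) (ht.mono hq)
  have hy := hy.mono (hr.trans hq)
  refine hy.infinite_of_mem
    (hy.inter_mem (hy.mem_of_finite_diff (h₁.mono hr) (hc.finite_colored_diff s hr)) h₂) ?_
  convert Set.finite_empty
  refine Set.eq_empty_of_forall_notMem ?_
  rintro i ⟨⟨k, hk, hi⟩, k', hk', hi'⟩
  obtain rfl : k = k' := Option.some_injective _ (hi.symm.trans hi')
  exact Set.disjoint_left.1 hst hk hk'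

/-- Otherwise the uncoloured places of a stronger condition would almost lie among places already
coloured, where colours persist up to finitely many; they would be finite in number. -/
theorem not_meetsColor_genericPoint (p : P) (s : Set κ) :
    ¬ Forces p (meetsColor col s (genericPoint.{v} col)) := by
  intro h
  obtain ⟨q, _, hf⟩ := hc.exists_colored_mem (hc.pointAt_genericPoint p) h
  obtain ⟨r, hr, hf⟩ := hc.forces_mem_genericPoint.1 hf q le_rfl
  refine hc.infinite_none r ((hf.union (hc.finite_colored_diff s hr)).subset fun i hi => ?_)
  by_cases h : i ∈ colored col s q
  · refine Or.inr ⟨h, ?_⟩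
    rintro ⟨k, _, hk⟩
    rw [Set.mem_ofPred_eq, hk] at hi
    cases hi
  · exact Or.inl ⟨hi, h⟩

theorem exists_meetsColor (hy : PointAt p y)
    (hne : Forces p (∼(y ≐ genericPoint col))) {ι : Type*} [Finite ι] {s : ι → Set κ}
    (hs : ⋃ i, s i = Set.univ) : ∃ q ≤ p, ∃ i, Forces q (meetsColor col (s i) y) := by
  have hx := hc.pointAt_genericPoint.{v} p
  -- If no set separated the two ultrafilters below `p`, each would be contained in the other and
  -- they would be forced equal.
  obtain ⟨q, hq, A, hA, hA'⟩ : ∃ q ≤ p, ∃ A, Forces q (setName P A ∊ y) ∧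
      Forces q (setName P Aᶜ ∊ genericPoint.{v} col) := by
    by_contra! hcon
    refine hne p le_rfl (forces_eq_of_mem_iff fun z q hq => ⟨fun hz => ?_, fun hz => ?_⟩)
    · refine forces_of_dense fun r hr => ?_
      obtain ⟨t, ht, A, hA⟩ := hy.exists_eq r (hr.trans hq) z (hz.mono hr)
      obtain ⟨w, hw, hf⟩ := hx.decides t (ht.trans (hr.trans hq)) A
      refine ⟨w, hw.trans ht, (hA.symm.mono hw).mem_congr_left (hf.resolve_right ?_)⟩
      exact hcon w (hw.trans (ht.trans (hr.trans hq))) A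
        ((hA.mono hw).mem_congr_left (hz.mono (hw.trans (ht.trans hr))))
    · refine forces_of_dense fun r hr => ?_
      obtain ⟨t, ht, A, hA⟩ := hx.exists_eq r (hr.trans hq) z (hz.mono hr)
      obtain ⟨w, hw, hf⟩ := hy.decides t (ht.trans (hr.trans hq)) A
      refine ⟨w, hw.trans ht, (hA.symm.mono hw).mem_congr_left (hf.resolve_right fun hf => ?_)⟩
      refine hcon w (hw.trans (ht.trans (hr.trans hq))) Aᶜ hf ?_
      rw [compl_compl]
      exact (hA.mono hw).mem_congr_left (hz.mono (hw.trans (ht.trans hr)))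
  obtain ⟨r, hr, hfin⟩ := hc.forces_mem_genericPoint.1 hA' q le_rfl
  have hy := hy.mono (hr.trans hq)
  by_contra! hcon
  -- The places of `A` uncoloured by `r` are finite in number. If `y` met no class, the finitely
  -- many complements of the classes would be in `y` and would cut `A` down to a finite set.
  have hall : ∀ i, Forces r (setName P (colored col (s i) r)ᶜ ∊ y) := by
    refine fun i => forces_of_dense fun t ht => ?_
    obtain ⟨w, hw, hf⟩ := hy.decides t ht (colored col (s i) r)
    refine ⟨w, hw, hf.resolve_left fun hf => ?_⟩
    exact hcon w (hw.trans (ht.trans (hr.trans hq))) i (forces_meetsColor_of_dense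
      fun v hv => ⟨v, le_rfl, r, hv.trans (hw.trans ht), hf.mono hv⟩)
  obtain ⟨F, _, _, hF⟩ := hy.exists_filter r le_rfl
  have h₁ := Filter.inter_mem ((hF A).2 (hA.mono hr))
    (Filter.iInter_mem.2 fun i => (hF _).2 (hall i))
  refine hy.infinite_of_mem ((hF _).1 h₁) (hfin.subset ?_)
  rintro n ⟨hn, hn'⟩
  refine ⟨?_, not_not.2 hn⟩
  by_contra hne
  obtain ⟨k, hk⟩ := Option.ne_none_iff_exists'.1 hne
  obtain ⟨i, hi⟩ := Set.mem_iUnion.1 (hs ▸ Set.mem_univ k : k ∈ ⋃ i, s i)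
  exact Set.mem_iInter.1 hn' i ⟨k, hi, hk⟩

/-- A neighbourhood of `x` is given by a set `A` almost containing the uncoloured places of some
condition. Colouring infinitely many of these with `k ∈ s` leaves room in `A` for a free ground
model ultrafilter in the neighbourhood. -/
theorem forces_accumulatesTo (hσ : SigmaClosed P) {s : Set κ} (hs : s.Nonempty)
    {C : PName.{0, v} P}
    (hC : ∀ q ≤ p, ∀ y, PointAt q y → Forces q (meetsColor col s y) → Forces q (y ∊ C)) :
    Forces p (accumulatesTo (omegaName P) C (genericPoint col)) := by
  refine fun U => forces_imp.2 fun q hq hU => forces_imp.2 fun r hr hx => forces_ex.2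
    fun t ht => ?_
  obtain ⟨w, hw, a, ha, hay⟩ := forces_ex.1 (forces_imp.1 (hU.2 _) r hr hx) t ht
  obtain ⟨w₁, hw₁, A, hA⟩ := exists_eq_of_mem_familyName ha
  obtain ⟨w₂, hw₂, hfin⟩ :=
    hc.forces_mem_genericPoint.1 (hA.mem_congr_left (ha.mono hw₁)) w₁ le_rfl
  obtain ⟨k, hk⟩ := hs
  obtain ⟨w₃, hw₃, hinf⟩ := hc.exists_some w₂ k
  have hB : (A ∩ colored col s w₃).Infinite := by
    refine fun hf => hinf ((hf.union hfin).subset fun i ⟨hi, hi'⟩ => ?_)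
    by_cases h : i ∈ A
    · exact Or.inl ⟨h, k, hk, hi'⟩
    · exact Or.inr ⟨hi, h⟩
  have := Filter.cofinite_inf_principal_neBot_iff.2 hB
  let u : Ultrafilter ℕ := Ultrafilter.of (Filter.cofinite ⊓ Filter.principal
    (A ∩ colored col s w₃))
  have hu : (u : Filter ℕ) ≤ Filter.cofinite ⊓ Filter.principal (A ∩ colored col s w₃) :=
    Ultrafilter.of_le _
  have hu' : A ∩ colored col s w₃ ∈ u := Filter.le_principal_iff.1 (hu.trans inf_le_right)
  have hpt := pointAt_ultrafilterName.{v} w₃ (hu.trans inf_le_left)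
  have hm : Forces w₃ (meetsColor col s (ultrafilterName.{v} u)) :=
    forces_meetsColor_of_dense fun v hv => ⟨v, le_rfl, w₃, hv,
      forces_setName_mem_ultrafilterName.2 (Filter.mem_of_superset hu' Set.inter_subset_right)⟩
  have h₃₁ : w₃ ≤ w₁ := hw₃.trans hw₂
  have h₃ : w₃ ≤ t := h₃₁.trans (hw₁.trans hw)
  refine ⟨w₃, h₃, ultrafilterName u, ?_,
    hC w₃ (h₃.trans (ht.trans (hr.trans hq))) _ hpt hm, fun v hv he => ?_⟩
  · refine forces_imp.1 (forces_imp.1 (hay _) w₃ (h₃₁.trans hw₁) (hpt.forces hσ)) w₃ le_rfl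
      ((hA.symm.mono h₃₁).mem_congr_left (forces_setName_mem_ultrafilterName.2 ?_))
    exact Filter.mem_of_superset hu' Set.inter_subset_left
  · exact hc.not_meetsColor_genericPoint v s (congruent_meets _ he (hm.mono hv))

/-- The two closed sets are complements of the open sets belonging to `{k}ᶜ` and `{k}ᶜᶜ`, so `x`
lies in both automatically. They meet nowhere else because the two open sets cover all other points.
-/
theorem forces_isTiePoint (hσ : SigmaClosed P) [Nontrivial κ] :
    Forces p (isTiePoint (omegaName P) (genericPoint.{v} col)) := by
  obtain ⟨k, k', hk⟩ := exists_pair_ne κ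
  have hcong := fun s : Set κ => (congruent_meets.{v} {a | a.1 = colored col s a.2}).neg
  have key : ∀ (s : Set κ) (q : P) (y : PName.{0, v} P), PointAt q y →
      Forces q (meetsColor col s y) → Forces q (y ∊ pointSet fun y => ∼(meetsColor col sᶜ y)) :=
    fun s q y hy hm => (forces_mem_pointSet hσ (hcong sᶜ)).2 ⟨hy, fun r hr hm' =>
      hc.not_meetsColor_of_disjoint (hy.mono hr) disjoint_compl_right (hm.mono hr) hm'⟩
  refine ⟨(hc.pointAt_genericPoint p).forces hσ,
    forces_ex_of (pointSet fun y => ∼(meetsColor col {k}ᶜ y))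
    (forces_ex_of (pointSet fun y => ∼(meetsColor col {k}ᶜᶜ y)) ⟨forces_isClosedSet_meets hσ _,
    forces_isClosedSet_meets hσ _, fun y => forces_imp.2 fun q _ hy => forces_or.2 fun r hr => ?_,
    fun y => forces_iff.2 fun q _ => ?_, hc.forces_accumulatesTo hσ (s := {k}) ⟨k, rfl⟩
    fun q _ y => key {k} q y,
    hc.forces_accumulatesTo hσ (s := {k}ᶜ) ⟨k', hk.symm⟩ fun q _ y => key {k}ᶜ q y⟩)⟩
  · have hy := (pointAt_of_forces hσ hy).mono hr
    obtain ⟨t, ht, hm | hm⟩ := exists_decides r (meetsColor.{v} col {k} y)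
    · exact ⟨t, ht, Or.inl (key {k} t y (hy.mono ht) hm)⟩
    · refine ⟨t, ht, Or.inr ((forces_mem_pointSet hσ (hcong _)).2 ⟨hy.mono ht, ?_⟩)⟩
      rw [compl_compl]
      exact hm
  · refine ⟨fun ⟨h₁, h₂⟩ => ?_, fun h => ?_⟩
    · obtain ⟨hy, h₁⟩ := (forces_mem_pointSet hσ (hcong _)).1 h₁
      obtain ⟨-, h₂⟩ := (forces_mem_pointSet hσ (hcong _)).1 h₂
      refine forces_by_contra fun r hr hne => ?_
      obtain ⟨t, ht, b, hm⟩ := hc.exists_meetsColor (hy.mono hr) hne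
        (s := fun b : Bool => bif b then {k}ᶜ else {k}ᶜᶜ) (by
          rw [← Set.union_eq_iUnion, Set.union_compl_self])
      cases b
      exacts [h₂ t (ht.trans hr) hm, h₁ t (ht.trans hr) hm]
    · have hx := (hc.pointAt_genericPoint.{v} q).congr h.symm
      have hx' : ∀ s : Set κ, Forces q (y ∊ pointSet fun y => ∼(meetsColor col s y)) := fun s =>
        (forces_mem_pointSet hσ (hcong s)).2 ⟨hx, fun r hr hm =>
          hc.not_meetsColor_genericPoint r s (congruent_meets _ (h.mono hr) hm)⟩
      exact ⟨hx' _, hx' _⟩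

theorem forces_tauGe (hσ : SigmaClosed P) {n : ℕ} {f : κ → Fin n} (hf : f.Surjective) :
    Forces p (tauGe n (omegaName P) (genericPoint.{v} col)) := by
  have hmem := fun (s : Set κ) {q : P} {y : PName.{0, v} P} =>
    forces_mem_pointSet (p := q) (y := y) hσ (congruent_meets.{v} {a | a.1 = colored col s a.2})
  -- Each piece is open, so it is its own open trace; the trace of its complement is the open set of
  -- the complementary colours.
  refine forces_exs_of (fun i => pointSet (meetsColor col (f ⁻¹' {i}))) ⟨forces_bigAnd.2 fun i =>
    ⟨⟨fun y => forces_imp.2 fun q _ hy => ?_, forces_ex_of (pointSet (meetsColor col (f ⁻¹' {i})))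
      ⟨forces_isOpenSet_meets hσ _, fun y => forces_imp.2 fun q _ _ => forces_imp.2
        fun r _ _ => forces_iff.2 fun _ _ => Iff.rfl⟩,
      forces_ex_of (pointSet (meetsColor col (f ⁻¹' {i})ᶜ)) ⟨forces_isOpenSet_meets hσ _,
        fun y => forces_imp.2 fun q _ hy => forces_imp.2 fun r hr hne => forces_iff.2
        fun t ht => ⟨fun h w hw hn => ?_, fun h => ?_⟩⟩⟩,
      hc.forces_accumulatesTo hσ (s := f ⁻¹' {i}) (hf i) fun q _ y hy hm => (hmem _).2 ⟨hy, hm⟩⟩,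
    forces_bigAnd.2 fun i => forces_bigAnd.2 fun j => ?_,
    fun y => forces_imp.2 fun q _ hy => forces_imp.2 fun r hr hne => forces_bigOr.2 fun t ht => ?_⟩
  · obtain ⟨hy, hm⟩ := (hmem _).1 hy
    exact ⟨hy.forces hσ, fun r hr he =>
      hc.not_meetsColor_genericPoint r _ (congruent_meets _ he (hm.mono hr))⟩
  · obtain ⟨hy, hm⟩ := (hmem _).1 h
    exact hc.not_meetsColor_of_disjoint (hy.mono hw) disjoint_compl_left (hm.mono hw)
      ((hmem _).1 hn).2
  · have hy := (pointAt_of_forces hσ hy).mono (ht.trans hr)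
    refine (hmem _).2 ⟨hy, forces_of_dense fun w hw => ?_⟩
    obtain ⟨v, hv, b, hm⟩ := hc.exists_meetsColor (hy.mono hw) (hne.mono (hw.trans ht))
      (s := fun b : Bool => bif b then f ⁻¹' {i} else (f ⁻¹' {i})ᶜ) (by
        rw [← Set.union_eq_iUnion, Set.union_compl_self])
    cases b
    · exact ⟨v, hv, hm⟩
    · exact (h v (hv.trans hw) ((hmem _).2 ⟨hy.mono (hv.trans hw), hm⟩)).elim
  · split_ifs with hij
    · exact forces_verum
    · refine fun y q _ ⟨h₁, h₂⟩ => ?_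
      obtain ⟨hy, h₁⟩ := (hmem _).1 h₁
      refine hc.not_meetsColor_of_disjoint hy ?_ h₁ ((hmem _).1 h₂).2
      exact Disjoint.preimage f (Set.disjoint_singleton.2 hij)
  · have hy := (pointAt_of_forces hσ hy).mono (ht.trans hr)
    obtain ⟨w, hw, i, hm⟩ := hc.exists_meetsColor hy (hne.mono ht)
      (s := fun i => f ⁻¹' {i}) (by
        rw [← Set.preimage_iUnion, Set.iUnion_of_singleton, Set.preimage_univ])
    exact ⟨w, hw, i, (hmem _).2 ⟨hy.mono hw, hm⟩⟩

theorem forces_existsTiePointTauGe (hσ : SigmaClosed P) [Nontrivial κ] {n : ℕ} {f : κ → Fin n}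
    (hf : f.Surjective) (p : P) : Forces p (existsTiePointTauGe (PName.{0, v} P) n) :=
  forces_ex_of (omegaName P) ⟨forces_isOmega, forces_ex_of (genericPoint col)
    ⟨hc.forces_isTiePoint hσ, hc.forces_tauGe hσ hf⟩⟩

end ColoringSystem

/-! ## The intervals and the growth condition -/

section Blocks

variable {b n : ℕ} {A : Set ℕ}

theorem finite_block (b n : ℕ) : (block b n).Finite := Set.finite_Ico _ _

/-- The logarithm recovers the block of a place, which makes block-by-block definitions possible.
The place `0` is in no block, though its logarithm is `0`. -/
theorem log_eq_of_mem_block {i : ℕ} (hb : 2 ≤ b) (hi : i ∈ block b n) : Nat.log b i = n :=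
  (Nat.log_eq_iff (Or.inr ⟨hb, (Nat.pos_of_ne_zero (by
    rintro rfl
    exact absurd hi.1 (Nat.not_le.2 (by positivity)))).ne'⟩)).2 ⟨hi.1, hi.2⟩

theorem mem_block_log {i : ℕ} (hb : 2 ≤ b) (hi : i ≠ 0) : i ∈ block b (Nat.log b i) :=
  ⟨Nat.pow_log_le_self b hi, Nat.lt_pow_succ_log_self hb i⟩

theorem log_eq_log_of_mem_block_iff {i k : ℕ} (hb : 2 ≤ b)
    (h : ∀ n, k ∈ block b n ↔ i ∈ block b n) : Nat.log b k = Nat.log b i := by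
  rcases eq_or_ne i 0 with rfl | hi
  · rcases eq_or_ne k 0 with rfl | hk
    · rfl
    · have := (h _).1 (mem_block_log hb hk)
      exact absurd this.1 (Nat.not_le.2 (by positivity))
  · exact log_eq_of_mem_block hb ((h _).2 (mem_block_log hb hi))

theorem growth_iff : Growth b A ↔ ∀ m : ℕ, ∃ᶠ n in Filter.atTop, m ≤ (block b n \ A).ncard := by
  have key : ∀ m n : ℕ, (m : ℕ∞) ≤ (block b n \ A).encard ↔ m ≤ (block b n \ A).ncard := by
    intro m n
    rw [← ((finite_block b n).sdiff).cast_ncard_eq, Nat.cast_le]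
  refine ⟨fun h m => ?_, fun h => ?_⟩
  · by_contra hc
    rw [Filter.not_frequently] at hc
    have : Filter.limsup (fun n => (block b n \ A).encard) Filter.atTop ≤ m :=
      Filter.limsup_le_of_le (h := hc.mono fun n hn => le_of_not_ge fun h => hn ((key m n).1 h))
    rw [h] at this
    exact absurd this (by simp)
  · refine ENat.eq_top_iff_forall_ge.2 fun m => ?_
    exact Filter.le_limsup_of_frequently_le ((h m).mono fun n hn => (key m n).2 hn)

theorem ncard_block (b n : ℕ) : (block b n).ncard = b ^ n * (b - 1) := by
  rw [block, Set.ncard_eq_toFinset_card', Set.toFinset_Ico, Nat.card_Ico, pow_succ,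
    Nat.mul_sub_one]

theorem growth_empty (hb : 2 ≤ b) : Growth b ∅ := by
  refine growth_iff.2 fun m => Filter.Eventually.frequently ?_
  filter_upwards [Filter.eventually_ge_atTop m] with n hn
  rw [Set.sdiff_empty, ncard_block]
  calc m ≤ n := hn
    _ ≤ b ^ n := (Nat.lt_pow_self hb).le
    _ ≤ b ^ n * (b - 1) := Nat.le_mul_of_pos_right _ (by lia)

end Blocks

/-! ## Orbits of partial functions -/

section Orbits

variable {ℓ : ℕ} {g h : ℕ → Option ℕ} {i j k : ℕ}

theorem piter_add (g : ℕ → Option ℕ) (a b i : ℕ) :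
    piter g (a + b) i = (piter g a i).bind (piter g b) := by
  induction b with
  | zero => simp only [add_zero]; cases piter g a i <;> rfl
  | succ b ih =>
    rw [← add_assoc, piter, ih]
    cases piter g a i <;> rfl

/-- The set `{i, g i, …, g ^ ℓ i}`. -/
def orbit (ℓ : ℕ) (g : ℕ → Option ℕ) (i : ℕ) : Set ℕ := {j | ∃ k ≤ ℓ, piter g k i = some j}

theorem self_mem_orbit (ℓ : ℕ) (g : ℕ → Option ℕ) (i : ℕ) : i ∈ orbit ℓ g i :=
  ⟨0, Nat.zero_le _, rfl⟩

theorem mem_pdom_iff : i ∈ pdom g ↔ ∃ k, g i = some k := Option.isSome_iff_exists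

theorem notMem_pdom_iff : i ∉ pdom g ↔ g i = none := by
  rw [mem_pdom_iff, ← Option.ne_none_iff_exists', not_not]

/-! ### Cyclic conditions as disjoint unions of cycles of length `ℓ` -/

namespace IsCyclicCond

variable (hg : IsCyclicCond ℓ g)

include hg

/-- Injectivity cancels steps from the front, so an orbit that repeats a value returns to its
starting point. -/
theorem piter_sub (a d : ℕ) {w : ℕ} (ha : piter g a i = some w) (had : piter g (a + d) i = some w) :
    piter g d i = some i := by
  induction a generalizing w with
  | zero =>
    cases ha
    rwa [Nat.zero_add] at had
  | succ a ih =>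
    rw [Nat.add_right_comm] at had
    obtain ⟨x, hx, hx'⟩ := Option.bind_eq_some_iff.1 ha
    obtain ⟨y, hy, hy'⟩ := Option.bind_eq_some_iff.1 had
    obtain rfl := hg.inj x y w hx' hy'
    exact ih hx hy

omit hg in
theorem piter_mod {d : ℕ} (hd : piter g d i = some i) (k : ℕ) :
    piter g k i = piter g (k % d) i := by
  have hm : ∀ m, piter g (d * m) i = some i := by
    intro m
    induction m with
    | zero => rfl
    | succ m ih => rw [Nat.mul_succ, piter_add, ih]; exact hd
  conv_lhs => rw [← Nat.div_add_mod k d, piter_add, hm]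
  rfl

/-- Pigeonhole on the `ℓ + 1` iterates and `ℓ` values gives a period `d ≤ ℓ`; a period `d` allows
only `d` values, so `d = ℓ`. -/
theorem piter_self (hi : i ∈ pdom g) : piter g ℓ i = some i := by
  have hsome : ∀ k ≤ ℓ, piter g k i = some ((piter g k i).getD 0) := fun k hk => by
    obtain ⟨j, hj⟩ := Option.isSome_iff_exists.1 (hg.orbit_defined i hi k hk)
    rw [hj, Option.getD_some]
  have hcard := hg.orbit_card i hi
  have hnot : ¬ Set.InjOn (fun k => (piter g k i).getD 0) (Set.Iic ℓ) := by
    intro hinj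
    have h₁ := hinj.encard_image
    have h₂ : (fun k => (piter g k i).getD 0) '' Set.Iic ℓ =
        {j | ∃ k ≤ ℓ, piter g k i = some j} := by
      ext j
      constructor
      · rintro ⟨k, hk, rfl⟩
        exact ⟨k, hk, hsome k hk⟩
      · rintro ⟨k, hk, hj⟩
        exact ⟨k, hk, by simp only [hj, Option.getD_some]⟩
    rw [h₂, hcard, ← (Set.finite_Iic ℓ).cast_ncard_eq, Nat.cast_inj,
      Set.ncard_eq_toFinset_card', Set.toFinset_Iic, Nat.card_Iic] at h₁
    lia
  have hex : ∃ d, 1 ≤ d ∧ d ≤ ℓ ∧ piter g d i = some i := by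
    rw [Set.InjOn] at hnot
    push Not at hnot
    obtain ⟨a, ha, c, hc, hac, hne⟩ := hnot
    have hac : piter g a i = piter g c i := by rw [hsome a ha, hsome c hc]; exact congrArg _ hac
    rw [Set.mem_Iic] at ha hc
    rcases Nat.lt_or_gt_of_ne hne with hlt | hlt
    · exact ⟨c - a, by lia, by lia, hg.piter_sub a (c - a) (hsome a ha)
        (by rw [Nat.add_sub_cancel' hlt.le, ← hac]; exact hsome a ha)⟩
    · exact ⟨a - c, by lia, by lia, hg.piter_sub c (a - c) (hsome c hc)
        (by rw [Nat.add_sub_cancel' hlt.le, hac]; exact hsome c hc)⟩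
  obtain ⟨d, hd, hdℓ, hdi⟩ := hex
  have hsub : {j | ∃ k ≤ ℓ, piter g k i = some j} ⊆
      (fun k => (piter g k i).getD 0) '' Set.Iio d := by
    rintro j ⟨k, _, hj⟩
    rw [piter_mod hdi k] at hj
    exact ⟨k % d, Nat.mod_lt _ hd, by simp only [hj, Option.getD_some]⟩
  have hle := (Set.encard_le_encard hsub).trans (Set.encard_image_le _ _)
  rw [hcard, ← (Set.finite_Iio d).cast_ncard_eq, Nat.cast_le,
    Set.ncard_eq_toFinset_card', Set.toFinset_Iio, Nat.card_Iio] at hle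
  obtain rfl : d = ℓ := le_antisymm hdℓ hle
  exact hdi

theorem ne_zero (hi : i ∈ pdom g) : ℓ ≠ 0 := by
  rintro rfl
  have h := hg.orbit_card i hi
  rw [Nat.cast_zero, Set.encard_eq_zero] at h
  exact Set.eq_empty_iff_forall_notMem.1 h i ⟨0, le_rfl, rfl⟩

theorem mem_orbit_of_piter (hi : i ∈ pdom g) (hk : piter g k i = some j) : j ∈ orbit ℓ g i := by
  rw [piter_mod (hg.piter_self hi)] at hk
  exact ⟨_, (Nat.mod_lt _ (Nat.pos_of_ne_zero (hg.ne_zero hi))).le, hk⟩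

theorem mem_pdom_of_mem_orbit (hi : i ∈ pdom g) (hj : j ∈ orbit ℓ g i) : j ∈ pdom g := by
  obtain ⟨k, hk, hj⟩ := hj
  rcases hk.lt_or_eq with hk | rfl
  · obtain ⟨m, hm⟩ := Option.isSome_iff_exists.1 (hg.orbit_defined i hi (k + 1) hk)
    rw [piter, hj] at hm
    exact mem_pdom_iff.2 ⟨m, hm⟩
  · rw [hg.piter_self hi] at hj
    cases hj
    exact hi

theorem orbit_subset (hi : i ∈ pdom g) (hj : j ∈ orbit ℓ g i) : orbit ℓ g j ⊆ orbit ℓ g i := by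
  rintro m ⟨k, hk, hm⟩
  obtain ⟨a, ha, hj⟩ := hj
  refine hg.mem_orbit_of_piter (k := a + k) hi ?_
  rw [piter_add, hj]
  exact hm

theorem mem_orbit_symm (hi : i ∈ pdom g) (hj : j ∈ orbit ℓ g i) : i ∈ orbit ℓ g j := by
  obtain ⟨a, ha, hj⟩ := hj
  have := hg.piter_self hi
  rw [← Nat.add_sub_cancel' ha, piter_add, hj] at this
  exact ⟨ℓ - a, Nat.sub_le _ _, this⟩

theorem orbit_eq (hi : i ∈ pdom g) (hj : j ∈ orbit ℓ g i) : orbit ℓ g j = orbit ℓ g i :=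
  (hg.orbit_subset hi hj).antisymm
    (hg.orbit_subset (hg.mem_pdom_of_mem_orbit hi hj) (hg.mem_orbit_symm hi hj))

theorem mem_block_iff_of_piter {n : ℕ} (hk : piter g k i = some j) :
    j ∈ TieForcing.block ℓ n ↔ i ∈ TieForcing.block ℓ n := by
  induction k generalizing j with
  | zero =>
    cases hk
    rfl
  | succ k ih =>
    obtain ⟨m, hm, hj⟩ := Option.bind_eq_some_iff.1 hk
    rw [hg.block m j hj, ih hm]

theorem finite_orbit (hi : i ∈ pdom g) : (orbit ℓ g i).Finite :=
  Set.finite_of_encard_eq_coe (hg.orbit_card i hi)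

theorem ncard_orbit (hi : i ∈ pdom g) : (orbit ℓ g i).ncard = ℓ := by
  rw [Set.ncard_def, orbit, hg.orbit_card i hi, ENat.toNat_natCast]

theorem dvd_ncard_block_inter (n : ℕ) : ℓ ∣ (TieForcing.block ℓ n ∩ pdom g).ncard := by
  classical
  have hfin : (TieForcing.block ℓ n ∩ pdom g).Finite := (finite_block ℓ n).inter_of_left _
  -- The fibres of the map sending a place to its orbit are the orbits themselves, each of size `ℓ`.
  rw [Set.ncard_eq_toFinset_card _ hfin, Finset.card_eq_sum_card_image (orbit ℓ g)]
  refine Finset.dvd_sum fun s hs => ?_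
  obtain ⟨i, hi, rfl⟩ := Finset.mem_image.1 hs
  obtain ⟨hin, hi⟩ := hfin.mem_toFinset.1 hi
  rw [← Set.ncard_coe_finset]
  convert dvd_refl ℓ
  convert hg.ncard_orbit hi
  ext j
  rw [Finset.mem_coe, Finset.mem_filter, hfin.mem_toFinset]
  refine ⟨fun h => h.2 ▸ self_mem_orbit ℓ g j, fun hj => ⟨⟨?_, hg.mem_pdom_of_mem_orbit hi hj⟩,
    hg.orbit_eq hi hj⟩⟩
  obtain ⟨k, _, hj⟩ := hj
  exact (hg.mem_block_iff_of_piter hj).2 hin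

/-- The block has `ℓ ^ n * (ℓ - 1)` elements, a multiple of `ℓ` once `n ≥ 1`; block `0` has to be
left out. -/
theorem dvd_ncard_block_diff {n : ℕ} (hn : 1 ≤ n) :
    ℓ ∣ (TieForcing.block ℓ n \ pdom g).ncard := by
  have h := Set.ncard_inter_add_ncard_sdiff_eq_ncard (TieForcing.block ℓ n) (pdom g)
    (finite_block ℓ n)
  refine (Nat.dvd_add_right (hg.dvd_ncard_block_inter n)).1 ?_
  rw [h, ncard_block]
  exact (dvd_pow_self ℓ (by lia)).mul_right _

end IsCyclicCond

end Orbits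

/-! ## Constructions of conditions -/

section Constructions

variable {ℓ : ℕ} {g h : ℕ → Option ℕ} {i j k : ℕ}

/-- A finite set whose size is divisible by `ℓ` is the union of cycles of length `ℓ`. -/
theorem exists_cycles (hℓ : 1 ≤ ℓ) {F : Set ℕ} (hF : F.Finite) (hd : ℓ ∣ F.ncard) :
    ∃ σ : ℕ → ℕ, Set.MapsTo σ F F ∧ Set.InjOn σ F ∧
      ∀ i ∈ F, {j | ∃ k ≤ ℓ, σ^[k] i = j}.encard = ℓ := by
  classical
  have : NeZero ℓ := ⟨by lia⟩
  obtain ⟨m, hm⟩ := hd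
  have := hF.fintype
  have hcard : Fintype.card F = Fintype.card (Fin m × ZMod ℓ) := by
    rw [Fintype.card_prod, Fintype.card_fin, ZMod.card, mul_comm, ← hm,
      Set.ncard_eq_toFinset_card', Set.toFinset_card]
  -- Identify `F` with `m` copies of `ZMod ℓ` and rotate each copy.
  let e : F ≃ Fin m × ZMod ℓ := Fintype.equivOfCardEq hcard
  let τ : F → F := fun i => e.symm ((e i).1, (e i).2 + 1)
  have hτ : τ.Injective := by
    intro i j hij
    have := e.symm.injective hij
    rw [Prod.mk.injEq, add_left_inj] at this
    exact e.injective (Prod.ext this.1 this.2)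
  let σ : ℕ → ℕ := fun i => if hi : i ∈ F then τ ⟨i, hi⟩ else i
  have hσ : ∀ i : F, σ i = τ i := fun i => dif_pos i.2
  have hiter : ∀ (k : ℕ) (i : F), σ^[k] i = e.symm ((e i).1, (e i).2 + k) := by
    intro k i
    induction k with
    | zero => simp
    | succ k ih =>
      rw [Function.iterate_succ_apply', ih, hσ]
      simp only [τ, Equiv.apply_symm_apply, Nat.cast_add, Nat.cast_one, add_assoc]
  refine ⟨σ, fun i hi => ?_, fun i hi j hj hij => ?_, fun i hi => ?_⟩
  · rw [hσ ⟨i, hi⟩]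
    exact (τ _).2
  · rw [hσ ⟨i, hi⟩, hσ ⟨j, hj⟩] at hij
    exact congrArg Subtype.val (hτ (Subtype.ext hij))
  · have : {j | ∃ k ≤ ℓ, σ^[k] i = j} =
        (fun c : ZMod ℓ => ((e.symm ((e ⟨i, hi⟩).1, c) : F) : ℕ)) '' Set.univ := by
      ext j
      constructor
      · rintro ⟨k, _, rfl⟩
        exact ⟨_, trivial, (hiter k ⟨i, hi⟩).symm⟩
      · rintro ⟨c, _, rfl⟩
        refine ⟨(c - (e ⟨i, hi⟩).2).val, (ZMod.val_lt _).le, ?_⟩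
        rw [hiter _ ⟨i, hi⟩, ZMod.natCast_val, ZMod.cast_id, add_sub_cancel]
    rw [this, Function.Injective.encard_image, Set.encard_univ, ENat.card_eq_coe_fintype_card,
      ZMod.card]
    intro c d hcd
    have := e.symm.injective (Subtype.ext hcd)
    exact (Prod.mk.inj this).2

open Classical in
/-- The extension of `g` by `σ n` on `E n`, where `E n ⊆ b ^ (n + 1) ∖ b ^ n`. -/
noncomputable def extend (b : ℕ) (g : ℕ → Option ℕ) (E : ℕ → Set ℕ) (σ : ℕ → ℕ → ℕ)
    (i : ℕ) : Option ℕ :=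
  if i ∈ E (Nat.log b i) then some (σ (Nat.log b i) i) else g i

section Extend

variable {b n : ℕ} {E : ℕ → Set ℕ} {σ : ℕ → ℕ → ℕ}

theorem extend_of_mem (hb : 2 ≤ b) (hE : ∀ n, E n ⊆ block b n) (hi : i ∈ E n) :
    extend b g E σ i = some (σ n i) := by
  obtain rfl := log_eq_of_mem_block hb (hE n hi)
  exact if_pos hi

theorem extend_of_mem_pdom (hg : ∀ n, Disjoint (E n) (pdom g)) (hi : i ∈ pdom g) :
    extend b g E σ i = g i :=
  if_neg fun h => Set.disjoint_left.1 (hg _) h hi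

theorem notMem_pdom_extend (hb : 2 ≤ b) (hE : ∀ n, E n ⊆ block b n) (hi : i ∈ block b n) :
    i ∉ pdom (extend b g E σ) ↔ i ∉ pdom g ∧ i ∉ E n := by
  obtain rfl := log_eq_of_mem_block hb hi
  by_cases h : i ∈ E (Nat.log b i)
  · simp [h, notMem_pdom_iff, extend_of_mem hb hE h]
  · rw [notMem_pdom_iff, notMem_pdom_iff, extend, if_neg h, and_iff_left h]

theorem block_diff_pdom_extend (hb : 2 ≤ b) (hE : ∀ n, E n ⊆ block b n) (n : ℕ) :
    block b n \ pdom (extend b g E σ) = (block b n \ pdom g) \ E n := by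
  ext i
  constructor
  · rintro ⟨hi, h⟩
    rw [notMem_pdom_extend hb hE hi] at h
    exact ⟨⟨hi, h.1⟩, h.2⟩
  · rintro ⟨⟨hi, h⟩, h'⟩
    exact ⟨hi, (notMem_pdom_extend hb hE hi).2 ⟨h, h'⟩⟩

theorem piter_extend_of_mem (hb : 2 ≤ b) (hE : ∀ n, E n ⊆ block b n)
    (hσ : ∀ n, Set.MapsTo (σ n) (E n) (E n)) (hi : i ∈ E n) (k : ℕ) :
    piter (extend b g E σ) k i = some ((σ n)^[k] i) := by
  induction k with
  | zero => rfl
  | succ k ih =>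
    rw [piter, ih, Option.bind_some, extend_of_mem hb hE ((hσ n).iterate k hi),
      Function.iterate_succ_apply']

theorem piter_congr {g' : ℕ → Option ℕ} (hg : IsCyclicCond ℓ g) (hi : i ∈ pdom g)
    (hgg : ∀ j ∈ orbit ℓ g i, g' j = g j) (k : ℕ) : piter g' k i = piter g k i := by
  induction k with
  | zero => rfl
  | succ k ih =>
    rw [piter, piter, ih]
    cases hk : piter g k i with
    | none => rfl
    | some j => exact hgg j (hg.mem_orbit_of_piter hi hk)

/-- Old orbits stay in `pdom g`, new ones in a single `E n`, so the two kinds never interact. -/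
theorem isCyclicCond_extend (hℓ : 2 ≤ ℓ) (hg : IsCyclicCond ℓ g) (hE : ∀ n, E n ⊆ block ℓ n)
    (hdisj : ∀ n, Disjoint (E n) (pdom g)) (hσ : ∀ n, Set.MapsTo (σ n) (E n) (E n))
    (hinj : ∀ n, Set.InjOn (σ n) (E n))
    (hcard : ∀ n, ∀ i ∈ E n, {j | ∃ k ≤ ℓ, (σ n)^[k] i = j}.encard = ℓ)
    (hgrowth : Growth ℓ (pdom (extend ℓ g E σ))) : IsCyclicCond ℓ (extend ℓ g E σ) := by
  have hcases : ∀ {i k}, extend ℓ g E σ i = some k →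
      (∃ n, i ∈ E n ∧ σ n i = k) ∨ (i ∈ pdom g ∧ g i = some k) := by
    intro i k h
    by_cases hi : i ∈ E (Nat.log ℓ i)
    · rw [extend_of_mem hℓ hE hi] at h
      exact Or.inl ⟨_, hi, Option.some_injective _ h⟩
    · rw [extend, if_neg hi] at h
      exact Or.inr ⟨mem_pdom_iff.2 ⟨k, h⟩, h⟩
  have hval : ∀ {i k}, i ∈ pdom g → g i = some k → k ∈ pdom g := fun hi h =>
    hg.mem_pdom_of_mem_orbit hi (hg.mem_orbit_of_piter (k := 1) hi h)
  have hiter : ∀ {i}, i ∈ pdom g → ∀ k, piter (extend ℓ g E σ) k i = piter g k i := fun hi =>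
    piter_congr hg hi fun j hj => extend_of_mem_pdom hdisj (hg.mem_pdom_of_mem_orbit hi hj)
  refine ⟨fun i j k hi hj => ?_, fun i k hi m => ?_, fun i hi => ?_, fun i hi => ?_, hgrowth⟩
  · rcases hcases hi with ⟨n, hin, hi⟩ | ⟨hip, hi⟩ <;>
      rcases hcases hj with ⟨m, hjm, hj⟩ | ⟨hjp, hj⟩
    · obtain rfl : n = m := (log_eq_of_mem_block hℓ (hE n (hi ▸ hσ n hin))).symm.trans
        (log_eq_of_mem_block hℓ (hE m (hj ▸ hσ m hjm)))
      exact hinj n hin hjm (hi.trans hj.symm)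
    · exact (Set.disjoint_left.1 (hdisj n) (hi ▸ hσ n hin) (hval hjp hj)).elim
    · exact (Set.disjoint_left.1 (hdisj m) (hj ▸ hσ m hjm) (hval hip hi)).elim
    · exact hg.inj i j k hi hj
  · rcases hcases hi with ⟨n, hin, rfl⟩ | ⟨_, hi⟩
    · have h₁ := log_eq_of_mem_block hℓ (hE n hin)
      have h₂ := log_eq_of_mem_block hℓ (hE n (hσ n hin))
      refine ⟨fun h => ?_, fun h => ?_⟩
      · obtain rfl := h₂.symm.trans (log_eq_of_mem_block hℓ h)
        exact hE n hin
      · obtain rfl := h₁.symm.trans (log_eq_of_mem_block hℓ h)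
        exact hE n (hσ n hin)
    · exact hg.block i k hi m
  all_goals
    obtain ⟨k, hk⟩ := mem_pdom_iff.1 hi
    rcases hcases hk with ⟨n, hin, -⟩ | ⟨hip, -⟩
  · intro m _
    rw [piter_extend_of_mem hℓ hE hσ hin]
    rfl
  · intro m hm
    rw [hiter hip]
    exact hg.orbit_defined i hip m hm
  · simp only [piter_extend_of_mem hℓ hE hσ hin, Option.some.injEq]
    exact hcard n i hin
  · simp only [hiter hip]
    exact hg.orbit_card i hip

end Extend

/-! ### Gluing -/

/-- The partial function that agrees with `F n` on `b ^ (n + 1) ∖ b ^ n`. -/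
def glue (b : ℕ) (F : ℕ → ℕ → Option ℕ) (i : ℕ) : Option ℕ := F (Nat.log b i) i

theorem block_diff_pdom_glue {b : ℕ} (hb : 2 ≤ b) (F : ℕ → ℕ → Option ℕ) (n : ℕ) :
    block b n \ pdom (glue b F) = block b n \ pdom (F n) := by
  ext i
  refine and_congr_right fun hi => ?_
  rw [notMem_pdom_iff, notMem_pdom_iff, glue, log_eq_of_mem_block hb hi]

/-- Orbits never leave their block, so each orbit of the glued function is an orbit of a single `F
n`. -/
theorem isCyclicCond_glue (hℓ : 2 ≤ ℓ) {F : ℕ → ℕ → Option ℕ} (hF : ∀ n, IsCyclicCond ℓ (F n))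
    (hgrowth : Growth ℓ (pdom (glue ℓ F))) : IsCyclicCond ℓ (glue ℓ F) := by
  have hlog : ∀ {n i j k}, piter (F n) k i = some j → Nat.log ℓ j = Nat.log ℓ i := fun h =>
    log_eq_log_of_mem_block_iff hℓ fun _ => (hF _).mem_block_iff_of_piter h
  have hiter : ∀ k i, piter (glue ℓ F) k i = piter (F (Nat.log ℓ i)) k i := by
    intro k i
    induction k with
    | zero => rfl
    | succ k ih =>
      rw [piter, piter, ih]
      cases hk : piter (F (Nat.log ℓ i)) k i with
      | none => rfl
      | some j => rw [Option.bind_some, Option.bind_some, glue, hlog hk]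
  have hlog₁ : ∀ {n i j}, F n i = some j → Nat.log ℓ j = Nat.log ℓ i := fun h =>
    hlog (k := 1) h
  refine ⟨fun i j k hi hj => ?_, fun i k hi m => (hF _).block i k hi m, fun i hi k hk => ?_,
    fun i hi => ?_, hgrowth⟩
  · rw [glue] at hi hj
    have := (hlog₁ hi).symm.trans (hlog₁ hj)
    rw [this] at hi
    exact (hF _).inj i j k hi hj
  · rw [hiter]
    exact (hF _).orbit_defined i hi k hk
  · simp only [hiter]
    exact (hF _).orbit_card i hi

end Constructions

/-! ## The partial orders `P_ℓ` -/

section Color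

variable {ℓ : ℕ}

/-- Counting smaller elements ranks a finite `S` as `0, …, |S| - 1`; hence every colour occurs on
every cycle. -/
theorem exists_count_eq {S : Set ℕ} [DecidablePred (· ∈ S)] {k : ℕ} (hk : k < S.ncard) :
    ∃ i ∈ S, Nat.count (· ∈ S) i = k := by
  have hfin : S.Finite := Set.finite_of_ncard_pos (by lia)
  have h : ∀ hf : (Set.ofPred (· ∈ S)).Finite, k < hf.toFinset.card := fun hf => by
    rwa [Set.ncard_eq_toFinset_card S hfin] at hk
  exact ⟨Nat.nth (· ∈ S) k, Nat.nth_mem k h, Nat.count_nth h⟩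

open Classical in
/-- The colour of `i` under the condition `g` of `P_ℓ`: the value `g i` if `ℓ = 1`, and the
position of `i` in its orbit otherwise. -/
noncomputable def color (ℓ : ℕ) (g : ℕ → Option ℕ) (i : ℕ) : Option (Fin (max ℓ 2)) :=
  (g i).map fun k =>
    -- For a condition the number is already below `max ℓ 2`; the remainder only supplies the type.
    -- The maximum gives two colours when `ℓ = 1`.
    ⟨(if ℓ = 1 then k else Nat.count (· ∈ orbit ℓ g i) i) % max ℓ 2, Nat.mod_lt _ (by lia)⟩

theorem color_eq_none_iff {g : ℕ → Option ℕ} {i : ℕ} : color ℓ g i = none ↔ i ∉ pdom g := by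
  rw [color, Option.map_eq_none_iff, notMem_pdom_iff]

theorem color_congr {g h : ℕ → Option ℕ} {i : ℕ} (hi : g i = h i)
    (ho : ℓ ≠ 1 → orbit ℓ g i = orbit ℓ h i) : color ℓ g i = color ℓ h i := by
  rw [color, color, hi]
  refine Option.map_congr fun k _ => Fin.ext ?_
  by_cases hℓ : ℓ = 1
  · simp only [if_pos hℓ]
  · simp only [if_neg hℓ]
    rw [ho hℓ]

end Color

/-! ### Density arguments and countable closure for `P_ℓ` -/

namespace Cond

variable {ℓ : ℕ}

theorem isSplitCond {p : Cond ℓ} (h : ℓ = 1) : IsSplitCond p.1 := by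
  have := p.2
  rwa [if_pos h] at this

theorem isCyclicCond {p : Cond ℓ} (h : ℓ ≠ 1) : IsCyclicCond ℓ p.1 := by
  have := p.2
  rwa [if_neg h] at this

theorem growth (hℓ : 1 ≤ ℓ) (p : Cond ℓ) : Growth (max ℓ 2) (pdom p.1) := by
  by_cases h : ℓ = 1
  · subst h
    exact (isSplitCond rfl).growth
  · rw [max_eq_left (by lia)]
    exact (isCyclicCond h).growth

theorem dvd_ncard (hℓ : 1 ≤ ℓ) (p : Cond ℓ) {n : ℕ} (hn : 1 ≤ n) :
    ℓ ∣ (block (max ℓ 2) n \ pdom p.1).ncard := by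
  by_cases h : ℓ = 1
  · have : ∀ m, ℓ ∣ m := fun m => h ▸ one_dvd m
    exact this _
  · rw [max_eq_left (by lia)]
    exact (isCyclicCond h).dvd_ncard_block_diff hn

/-- The empty condition is the weakest one. -/
theorem exists_top (hℓ : 1 ≤ ℓ) : ∃ t : Cond ℓ, ∀ p, p ≤ t := by
  have hdom : pdom (fun _ => none) = ∅ := Set.eq_empty_of_forall_notMem fun i => by
    rw [notMem_pdom_iff]
  have hnot : ∀ i, i ∉ pdom (fun _ => none) := fun i => by rw [hdom]; exact Set.notMem_empty i
  refine ⟨⟨fun _ => none, ?_⟩, fun p => ?_⟩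
  · split_ifs with h
    · exact ⟨by simp, hdom ▸ growth_empty le_rfl⟩
    · exact ⟨by simp, by simp, fun i hi => (hnot i hi).elim, fun i hi => (hnot i hi).elim,
        hdom ▸ growth_empty (by lia)⟩
  · refine Set.finite_empty.subset ?_
    rintro i ⟨k, hk, -⟩
    cases hk

/-- A rank depends on the whole cycle, so a changed value can affect every place of its cycle, but
no other. Finitely many changes thus spoil finitely many finite cycles. -/
theorem finite_color_ne {p q : Cond ℓ} (h : q ≤ p) :
    {i | ∃ k, color ℓ p.1 i = some k ∧ color ℓ q.1 i ≠ some k}.Finite := by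
  have hB : {i | ∃ k, p.1 i = some k ∧ q.1 i ≠ some k}.Finite := h
  by_cases hℓ : ℓ = 1
  · refine hB.subset fun i ⟨k, hk, hk'⟩ => ?_
    obtain ⟨m, hm, -⟩ := Option.map_eq_some_iff.1 hk
    refine ⟨m, hm, fun hq => hk' ?_⟩
    rw [← hk]
    exact color_congr (hq.trans hm.symm) (absurd hℓ)
  · have hp := isCyclicCond (p := p) hℓ
    refine (hB.biUnion (t := orbit ℓ p.1) fun j ⟨k, hk, _⟩ =>
      hp.finite_orbit (mem_pdom_iff.2 ⟨k, hk⟩)).subset fun i ⟨k, hk, hk'⟩ => ?_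
    obtain ⟨m, hm, -⟩ := Option.map_eq_some_iff.1 hk
    have hi : i ∈ pdom p.1 := mem_pdom_iff.2 ⟨m, hm⟩
    by_contra hcon
    have hag : ∀ j ∈ orbit ℓ p.1 i, q.1 j = p.1 j := by
      intro j hj
      obtain ⟨m, hm⟩ := mem_pdom_iff.1 (hp.mem_pdom_of_mem_orbit hi hj)
      by_contra hne
      exact hcon (Set.mem_biUnion (x := j) ⟨m, hm, fun h => hne (h.trans hm.symm)⟩
        (hp.mem_orbit_symm hi hj))
    refine hk' ?_
    rw [← hk]
    refine color_congr (hag i (self_mem_orbit _ _ _)) fun _ => ?_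
    simp only [orbit, piter_congr hp hi hag]

/-- A condition can be extended to finite subsets of the intervals whose sizes are divisible by
`ℓ`, such that a given colour appears in each of them. -/
theorem exists_extension (hℓ : 1 ≤ ℓ) (p : Cond ℓ) {E : ℕ → Set ℕ}
    (hE : ∀ n, E n ⊆ block (max ℓ 2) n \ pdom p.1) (hd : ∀ n, ℓ ∣ (E n).ncard)
    (hgrowth : ∀ m : ℕ, ∃ᶠ n in Filter.atTop,
      m ≤ ((block (max ℓ 2) n \ pdom p.1) \ E n).ncard) (c : Fin (max ℓ 2)) :
    ∃ q ≤ p, (∀ n, ∀ i ∈ block (max ℓ 2) n, i ∉ pdom q.1 ↔ i ∉ pdom p.1 ∧ i ∉ E n) ∧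
      ∀ n, (E n).Nonempty → ∃ i ∈ E n, color ℓ q.1 i = some c := by
  have hb : 2 ≤ max ℓ 2 := le_max_right _ _
  have hEb : ∀ n, E n ⊆ block (max ℓ 2) n := fun n => (hE n).trans Set.sdiff_subset
  have hdisj : ∀ n, Disjoint (E n) (pdom p.1) := fun n =>
    Set.disjoint_left.2 fun i hi => (hE n hi).2
  have hgr : ∀ σ, Growth (max ℓ 2) (pdom (extend (max ℓ 2) p.1 E σ)) := fun σ =>
    growth_iff.2 fun m => (hgrowth m).mono fun n hn => by rwa [block_diff_pdom_extend hb hEb]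
  have hle : ∀ σ, AlmostSubset p.1 (extend (max ℓ 2) p.1 E σ) := fun σ => by
    refine Set.finite_empty.subset fun i ⟨k, hk, hk'⟩ => hk' ?_
    rw [extend_of_mem_pdom hdisj (mem_pdom_iff.2 ⟨k, hk⟩), hk]
  suffices ∃ q, (if ℓ = 1 then IsSplitCond q else IsCyclicCond ℓ q) ∧ AlmostSubset p.1 q ∧
      (∀ n, ∀ i ∈ block (max ℓ 2) n, i ∉ pdom q ↔ i ∉ pdom p.1 ∧ i ∉ E n) ∧
      ∀ n, (E n).Nonempty → ∃ i ∈ E n, color ℓ q i = some c from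
    let ⟨q, hq, h⟩ := this
    ⟨⟨q, hq⟩, h⟩
  by_cases h : ℓ = 1
  · subst h
    -- For `ℓ = 1` every new place simply gets the value `c`.
    refine ⟨extend (max 1 2) p.1 E fun _ _ => c, ?_, hle _,
      fun n i hi => notMem_pdom_extend hb hEb hi, fun n ⟨i, hi⟩ => ⟨i, hi, ?_⟩⟩
    · rw [if_pos rfl]
      refine ⟨fun i k hk => ?_, hgr _⟩
      rw [extend] at hk
      by_cases hi : i ∈ E (Nat.log (max 1 2) i)
      · rw [if_pos hi] at hk
        exact Option.some_injective _ hk ▸ c.2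
      · rw [if_neg hi] at hk
        exact (isSplitCond rfl).two i k hk
    · rw [color, extend_of_mem hb hEb hi, Option.map_some]
      refine congrArg some (Fin.ext ?_)
      simp only [if_pos]
      exact Nat.mod_eq_of_lt c.2
  · have hmax : max ℓ 2 = ℓ := max_eq_left (by lia)
    -- For `ℓ ≥ 2` split each `E n` into cycles; the place of rank `c` in any of them gets the
    -- colour.
    choose σ hσ hinj hcard using fun n =>
      exists_cycles hℓ ((finite_block _ n).subset (hEb n)) (hd n)
    have hq : IsCyclicCond ℓ (extend (max ℓ 2) p.1 E σ) := by
      have hgr := hgr σ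
      rw [hmax] at hEb hgr ⊢
      exact isCyclicCond_extend (by lia) (isCyclicCond h) hEb hdisj hσ hinj hcard hgr
    refine ⟨extend (max ℓ 2) p.1 E σ, ?_, hle _,
      fun n i hi => notMem_pdom_extend hb hEb hi, fun n ⟨i, hi⟩ => ?_⟩
    · rwa [if_neg h]
    · classical
      have hdom : i ∈ pdom (extend (max ℓ 2) p.1 E σ) :=
        mem_pdom_iff.2 ⟨_, extend_of_mem hb hEb hi⟩
      have hc : (c : ℕ) < (orbit ℓ (extend (max ℓ 2) p.1 E σ) i).ncard := by
        rw [hq.ncard_orbit hdom]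
        exact c.2.trans_eq hmax
      obtain ⟨j, hj, hjc⟩ := exists_count_eq hc
      have hjE : j ∈ E n := by
        obtain ⟨k, _, hk⟩ := hj
        rw [piter_extend_of_mem hb hEb hσ hi] at hk
        exact Option.some_injective _ hk ▸ (hσ n).iterate k hi
      refine ⟨j, hjE, ?_⟩
      rw [color, extend_of_mem hb hEb hjE, Option.map_some]
      refine congrArg some (Fin.ext ?_)
      simp only [if_neg h, hq.orbit_eq hdom hj]
      rw [← Nat.mod_eq_of_lt c.2, ← hjc]

theorem infinite_compl_pdom (hℓ : 1 ≤ ℓ) (p : Cond ℓ) : {i | i ∉ pdom p.1}.Infinite := by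
  intro hfin
  obtain ⟨n, hn⟩ := (growth_iff.1 (p.growth hℓ) ({i | i ∉ pdom p.1}.ncard + 1)).exists
  have := Set.ncard_le_ncard (s := block (max ℓ 2) n \ pdom p.1)
    (t := {i | i ∉ pdom p.1}) (fun i hi => hi.2) hfin
  lia

/-- Absorb the uncoloured places off `A` into the domain, together with fewer than `ℓ` places of `A`
per block to make the number divisible by `ℓ`. So small a loss keeps the growth condition. -/
theorem exists_le_finite_diff (hℓ : 1 ≤ ℓ) (p : Cond ℓ) {A : Set ℕ}
    (hA : ∀ m : ℕ, ∃ᶠ n in Filter.atTop, m ≤ ((block (max ℓ 2) n \ pdom p.1) ∩ A).ncard) :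
    ∃ q ≤ p, ({i | i ∉ pdom q.1} \ A).Finite := by
  have hb : 2 ≤ max ℓ 2 := le_max_right _ _
  have hfin : ∀ n, (block (max ℓ 2) n \ pdom p.1).Finite := fun n => (finite_block _ n).sdiff
  choose S hS hSc using fun n => Set.exists_subset_card_eq
    (Nat.mod_le ((block (max ℓ 2) n \ pdom p.1) ∩ A).ncard ℓ)
  -- Block `0` is skipped because its size need not be a multiple of `ℓ`. With `S n` removed, a
  -- multiple of `ℓ` places of `A` stays uncoloured, so `E n` has size divisible by `ℓ` as well.
  let E : ℕ → Set ℕ := fun n => if n = 0 then ∅ else ((block (max ℓ 2) n \ pdom p.1) \ A) ∪ S n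
  have hE₀ : ∀ n, n ≠ 0 → E n = ((block (max ℓ 2) n \ pdom p.1) \ A) ∪ S n := fun n hn => if_neg hn
  have h₁ : ∀ n, E n ⊆ block (max ℓ 2) n \ pdom p.1 := by
    intro n
    by_cases hn : n = 0
    · simp [E, hn]
    · rw [hE₀ n hn]
      exact Set.union_subset Set.sdiff_subset ((hS n).trans Set.inter_subset_left)
  have h₂ : ∀ n, ℓ ∣ (E n).ncard := by
    intro n
    by_cases hn : n = 0
    · simp [E, hn]
    · rw [hE₀ n hn, Set.ncard_union_eq (Set.disjoint_left.2 fun i hi hi' => hi.2 (hS n hi').2)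
        (hfin n).sdiff (((hfin n).inter_of_left A).subset (hS n)), hSc]
      have h₁ := p.dvd_ncard hℓ (Nat.pos_of_ne_zero hn)
      rw [← Set.ncard_inter_add_ncard_sdiff_eq_ncard _ A (hfin n), add_comm] at h₁
      refine (Nat.dvd_add_right (Nat.dvd_mul_right ℓ
        (((block (max ℓ 2) n \ pdom p.1) ∩ A).ncard / ℓ))).1 ?_
      rwa [add_left_comm, Nat.div_add_mod]
  have h₃ : ∀ m : ℕ, ∃ᶠ n in Filter.atTop, m ≤ ((block (max ℓ 2) n \ pdom p.1) \ E n).ncard := by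
    intro m
    refine ((hA (m + ℓ)).and_eventually (Filter.eventually_ge_atTop 1)).mono fun n ⟨hn, hn₁⟩ => ?_
    have hsub : ((block (max ℓ 2) n \ pdom p.1) ∩ A) \ S n ⊆
        (block (max ℓ 2) n \ pdom p.1) \ E n := by
      rw [hE₀ n (by lia)]
      rintro i ⟨⟨hi, hiA⟩, hiS⟩
      exact ⟨hi, fun h => h.elim (fun h => h.2 hiA) hiS⟩
    have h₁ := Set.ncard_le_ncard hsub (hfin n).sdiff
    have h₂ := Set.ncard_sdiff_add_ncard_of_subset (hS n) ((hfin n).inter_of_left A)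
    have h₃ := hSc n
    have h₄ := Nat.mod_lt ((block (max ℓ 2) n \ pdom p.1) ∩ A).ncard hℓ
    lia
  obtain ⟨q, hq, hdom, -⟩ := p.exists_extension hℓ h₁ h₂ h₃ ⟨0, by lia⟩
  refine ⟨q, hq, (Set.finite_Iio (max ℓ 2)).subset fun i ⟨hi, hiA⟩ => ?_⟩
  by_contra hib
  rw [Set.mem_Iio, not_lt] at hib
  have hin := mem_block_log hb (show i ≠ 0 by lia)
  have hlog : Nat.log (max ℓ 2) i ≠ 0 := (Nat.log_pos hb hib).ne'
  obtain ⟨h₁, h₂⟩ := (hdom _ i hin).1 hi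
  rw [hE₀ _ hlog] at h₂
  exact h₂ (Or.inl ⟨⟨hin, h₁⟩, hiA⟩)

theorem exists_decides (hℓ : 1 ≤ ℓ) (p : Cond ℓ) (A : Set ℕ) :
    ∃ q ≤ p, ({i | i ∉ pdom q.1} \ A).Finite ∨ ({i | i ∉ pdom q.1} \ Aᶜ).Finite := by
  by_cases h : ∀ m : ℕ, ∃ᶠ n in Filter.atTop, m ≤ ((block (max ℓ 2) n \ pdom p.1) ∩ A).ncard
  · obtain ⟨q, hq, hf⟩ := p.exists_le_finite_diff hℓ h
    exact ⟨q, hq, Or.inl hf⟩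
  · obtain ⟨q, hq, hf⟩ := p.exists_le_finite_diff hℓ (A := Aᶜ) fun m => by
      push Not at h
      obtain ⟨k, hk⟩ := h
      -- The part in `A` eventually has fewer than `k` elements, so `m + k` uncoloured places leave
      -- `m` off `A`.
      refine ((growth_iff.1 (p.growth hℓ) (m + k)).and_eventually hk).mono fun n ⟨hn, hnk⟩ => ?_
      rw [← Set.ncard_inter_add_ncard_sdiff_eq_ncard _ A (finite_block _ n).sdiff,
        Set.sdiff_eq _ A] at hn
      lia
    exact ⟨q, hq, Or.inr hf⟩

theorem exists_infinite_color (hℓ : 1 ≤ ℓ) (p : Cond ℓ) (c : Fin (max ℓ 2)) :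
    ∃ q ≤ p, {i | i ∉ pdom p.1 ∧ color ℓ q.1 i = some c}.Infinite := by
  have hb : 2 ≤ max ℓ 2 := le_max_right _ _
  have hfin : ∀ n, (block (max ℓ 2) n \ pdom p.1).Finite := fun n => (finite_block _ n).sdiff
  -- Colour exactly `ℓ` places, that is one cycle if `ℓ ≥ 2`, in each block that has room.
  have hex : ∀ n, ∃ E ⊆ block (max ℓ 2) n \ pdom p.1,
      E.ncard = if ℓ ≤ (block (max ℓ 2) n \ pdom p.1).ncard then ℓ else 0 := fun n =>
    Set.exists_subset_card_eq (by split_ifs <;> lia)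
  choose E hE hEc using hex
  have h₁ : ∀ n, ℓ ∣ (E n).ncard := by
    intro n
    rw [hEc]
    by_cases hn : ℓ ≤ (block (max ℓ 2) n \ pdom p.1).ncard
    · rw [if_pos hn]
    · rw [if_neg hn]
      exact dvd_zero ℓ
  have h₂ : ∀ m : ℕ, ∃ᶠ n in Filter.atTop, m ≤ ((block (max ℓ 2) n \ pdom p.1) \ E n).ncard := by
    intro m
    refine (growth_iff.1 (p.growth hℓ) (m + ℓ)).mono fun n hn => ?_
    have h₁ := Set.ncard_sdiff_add_ncard_of_subset (hE n) (hfin n)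
    have h₂ := hEc n
    split_ifs at h₂ <;> lia
  obtain ⟨q, hq, -, hcol⟩ := p.exists_extension hℓ hE h₁ h₂ c
  refine ⟨q, hq, Set.infinite_of_forall_exists_gt fun N => ?_⟩
  obtain ⟨n, hn, hnN⟩ := ((growth_iff.1 (p.growth hℓ) ℓ).and_eventually
    (Filter.eventually_ge_atTop N)).exists
  obtain ⟨i, hi, hic⟩ := hcol n (Set.nonempty_of_ncard_ne_zero (by
    rw [hEc, if_pos hn]
    lia))
  exact ⟨i, ⟨(hE n hi).2, hic⟩, hnN.trans_lt ((Nat.lt_pow_self hb).trans_le (hE n hi).1.1)⟩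

/-- Diagonalisation: use `f j` on the blocks after `φ (j - 1)` up to `φ j`. At `φ j` at least `j`
places are still uncoloured, and `f j` takes over only where it already extends all earlier
conditions exactly. -/
theorem sigmaClosed (hℓ : 1 ≤ ℓ) : SigmaClosed (Cond ℓ) := by
  intro f hf
  have hb : 2 ≤ max ℓ 2 := le_max_right _ _
  have hT : ∀ j, ∃ T, ∀ i ≤ j, ∀ x k, T ≤ Nat.log (max ℓ 2) x → (f i).1 x = some k →
      (f j).1 x = some k := by
    intro j
    have hfin : (⋃ i ∈ Set.Iic j, {x | ∃ k, (f i).1 x = some k ∧ (f j).1 x ≠ some k}).Finite :=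
      (Set.finite_Iic j).biUnion fun i hi => hf hi
    obtain ⟨B, hB⟩ := (hfin.image (Nat.log (max ℓ 2))).bddAbove
    refine ⟨B + 1, fun i hi x k hx hk => ?_⟩
    by_contra hne
    have := hB (Set.mem_image_of_mem _ (Set.mem_biUnion (x := i) hi ⟨k, hk, hne⟩))
    lia
  choose T hT using hT
  -- The index is `T (j + 1)` because `f (j + 1)` takes over right after block `φ j`.
  obtain ⟨φ, hφ, hφT⟩ := Filter.extraction_forall_of_frequently fun j =>
    (growth_iff.1 ((f j).growth hℓ) j).and_eventually (Filter.eventually_ge_atTop (T (j + 1)))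
  have hex : ∀ n, ∃ j, n ≤ φ j := fun n => ⟨n, hφ.le_apply⟩
  let J : ℕ → ℕ := fun n => Nat.find (hex n)
  have hJφ : ∀ j, J (φ j) = j := fun j =>
    (Nat.find_eq_iff _).2 ⟨le_rfl, fun m hm => not_le.2 (hφ hm)⟩
  have hJT : ∀ i n, φ i < n → i ≤ J n ∧ T (J n) ≤ n := by
    intro i n hn
    have hi : i < J n := (Nat.lt_find_iff _ _).2 fun m hm =>
      not_le.2 ((hφ.monotone hm).trans_lt hn)
    obtain ⟨m, hm⟩ := Nat.exists_eq_succ_of_ne_zero (show J n ≠ 0 by lia)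
    have hmn : φ m < n := not_le.1 (Nat.find_min (hex n) (show m < J n by lia))
    refine ⟨hi.le, ?_⟩
    rw [hm]
    exact (hφT m).2.trans hmn.le
  have hgrowth : Growth (max ℓ 2) (pdom (glue (max ℓ 2) fun n => (f (J n)).1)) := by
    refine growth_iff.2 fun m => Filter.frequently_atTop.2 fun N =>
      ⟨φ (max N m), (le_max_left N m).trans hφ.le_apply, ?_⟩
    rw [block_diff_pdom_glue hb]
    simp only [hJφ]
    exact (le_max_right N m).trans (hφT _).1
  refine ⟨⟨glue (max ℓ 2) fun n => (f (J n)).1, ?_⟩, fun i => ?_⟩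
  · split_ifs with h
    · subst h
      exact ⟨fun i k hk => (isSplitCond rfl).two i k hk, hgrowth⟩
    · have hmax : max ℓ 2 = ℓ := max_eq_left (by lia)
      rw [hmax] at hgrowth ⊢
      exact isCyclicCond_glue (by lia) (fun n => isCyclicCond h) hgrowth
  · refine (Set.finite_Iio ((max ℓ 2) ^ (φ i + 1))).subset fun x ⟨k, hk, hne⟩ => ?_
    by_contra hx
    rw [Set.mem_Iio, not_lt] at hx
    have hlog : φ i < Nat.log (max ℓ 2) x := Nat.le_log_of_pow_le hb hx
    obtain ⟨h₁, h₂⟩ := hJT i _ hlog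
    exact hne (hT _ i h₁ x k h₂ hk)

theorem coloringSystem (hℓ : 1 ≤ ℓ) : ColoringSystem fun p : Cond ℓ => color ℓ p.1 where
  almost_le _ _ h := finite_color_ne h
  infinite_none p := by
    simp only [color_eq_none_iff]
    exact p.infinite_compl_pdom hℓ
  decides p A := by
    simp only [color_eq_none_iff]
    exact p.exists_decides hℓ A
  exists_some p c := by
    simp only [color_eq_none_iff]
    exact p.exists_infinite_color hℓ c

end Cond

/-! ## Products -/

theorem SigmaClosed.pi {ι : Type u} {Q : ι → Type v} [∀ i, Preorder (Q i)]
    (h : ∀ i, SigmaClosed (Q i)) : SigmaClosed (∀ i, Q i) := by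
  intro f hf
  choose q hq using fun i => h i (fun n => f n i) fun m n hmn => hf hmn i
  exact ⟨q, fun n i => hq i n⟩

/-- A density argument in one factor is carried out by updating that coordinate alone. -/
theorem ColoringSystem.pi {ι κ : Type} {Q : ι → Type} [∀ i, Preorder (Q i)] (i : ι)
    {col : Q i → ℕ → Option κ} (h : ColoringSystem col) :
    ColoringSystem fun p : ∀ i, Q i => col (p i) := by
  classical
  refine ⟨fun p q hq => h.almost_le (hq i), fun p => h.infinite_none (p i), fun p A => ?_,
    fun p k => ?_⟩
  · obtain ⟨q, hq, hA⟩ := h.decides (p i) A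
    refine ⟨Function.update p i q, update_le_self_iff.2 hq, ?_⟩
    rwa [Function.update_self]
  · obtain ⟨q, hq, hk⟩ := h.exists_some (p i) k
    refine ⟨Function.update p i q, update_le_self_iff.2 hq, ?_⟩
    rwa [Function.update_self]

end TieForcing

theorem mainTheorem8 (L : Set ℕ) (hL : ∀ ℓ ∈ L, 1 ≤ ℓ) :
    ∀ ℓ ∈ L, TieForcing.HoldsInGenericExtensions (TieForcing.PStar L)
      (TieForcing.existsTiePointTauGe (TieForcing.PName.{0, v} (TieForcing.PStar L)) ℓ) := by
  intro ℓ hℓ p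
  choose t ht using fun k : L => TieForcing.Cond.exists_top (hL k k.2)
  let _ : OrderTop (TieForcing.PStar L) := { top := t, le_top := fun p k => ht k (p k) }
  have : Nontrivial (Fin (max ℓ 2)) := Fin.nontrivial_iff_two_le.2 (le_max_right ℓ 2)
  have hc : TieForcing.ColoringSystem fun p : TieForcing.PStar L =>
      TieForcing.color ℓ (p ⟨ℓ, hℓ⟩).1 :=
    TieForcing.ColoringSystem.pi (Q := fun k : L => TieForcing.Cond k) ⟨ℓ, hℓ⟩
      (TieForcing.Cond.coloringSystem (hL ℓ hℓ))
  have h1 := hL ℓ hℓ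
  refine hc.forces_existsTiePointTauGe
    (TieForcing.SigmaClosed.pi fun k => TieForcing.Cond.sigmaClosed (hL k k.2))
    -- The colour map is the identity for `ℓ ≥ 2` and merges the two colours for `ℓ = 1`.
    (f := fun i => ⟨min i (ℓ - 1), by lia⟩) (fun j => ⟨⟨j, by lia⟩, Fin.ext ?_⟩) p
  exact min_eq_left (by lia)
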